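/- For $t\ge 0$ let $$\Psi(t)=4(e^{t/2}+e^{-t/2}-2)-\sum_{n\le e^t}\frac{\Lambda(n)}{\sqrt n}(t-\log n)+\frac t2\Big[\frac{\Gamma'}{\Gamma}\Big(\frac14\Big)-\log\pi\Big]+\frac14\big(C-e^{-t/2}\Phi(e^{-2t},2,1/4)\big),$$ where $\Lambda$ is the von Mangoldt function, $C=\pi^2+8\sum_{n\ge0}(-1)^n(2n+1)^{-2}$ and $\Phi(z,s,\alpha)=\sum_{n\ge0}(n+\alpha)^{-s}z^n$; extend $\Psi$ to an even function on $\mathbb R$. Put $g=-\Psi$, $G_g(t,u)=g(t-u)-g(t)-g(-u)+g(0)$ and, for $a>0$ and functions $\phi_1,\phi_2$ supported in $[-a,a]$, $$\langle\phi_1,\phi_2\rangle_{G_g,a}=\int_{-a}^a\int_{-a}^a G_g(t,u)\,\phi_1(u)\overline{\phi_2(t)}\,du\,dt .$$ For $\phi\in L^2(-a,a)$ (complex-valued, extended by zero to $\mathbb R$) put $\widehat\phi(z)=\int_{-a}^{a}\phi(t)e^{izt}\,dt$ and $\Phi_1(\phi,z)=(\widehat\phi(z)-\widehat\phi(0))/z$.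 For $a>0$ and an integer $N\ge0$, let $K_N(a)$ be the set of functions $\psi:\mathbb R\to\mathbb C$ that vanish for $|t|>a$, coincide on $[-a,a]$ with a $C^\infty$ function of period $2a$ on $\mathbb R$, and satisfy $\int_{-a}^a\psi(x)e^{\pi i n x/a}\,dx=0$ for all integers $n$ with $|n|\le N$. Let $\mathfrak K_{N,0}(a)$ be the set of $\phi\in L^2(-a,a)$ such that $\widehat\phi(0)=0$ and the primitive $t\mapsto\int_{-a}^t\phi(u)\,du$ belongs to $K_N(a)$. **Theorem.** Let $a_0>0$ and $\mu>0$ be given. Then there exists an integer $N\ge0$ such that, for every $0<a\le a_0$ and every $\phi\in\mathfrak K_{N,0}(a)$, the integral defining $\langle\phi,\phi\rangle_{G_g,a}$ converges absolutely, its value is real, $\int_{-\infty}^\infty|\Phi_1(\phi,z)|^2\,dz<\infty$, and $$\langle\phi,\phi\rangle_{G_g,a}\ \ge\ \mu\int_{-\infty}^{\infty}|\Phi_1(\phi,z)|^2\,dz .$$ -/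

import Mathlib

open scoped ContDiff

noncomputable section

namespace ZetaScrew

/-- Catalan's constant `∑ (-1)^n / (2n+1)^2`. -/
def catalan : ℝ := ∑' n : ℕ, (-1 : ℝ) ^ n / (2 * (n : ℝ) + 1) ^ 2

/-- The Hurwitz--Lerch zeta function `Φ(z,s,a) = ∑ (n+a)^{-s} z^n` at real arguments. -/
def hurwitzLerch (z s a : ℝ) : ℝ := ∑' n : ℕ, ((n : ℝ) + a) ^ (-s) * z ^ n

/-- The function `Ψ` for a non-negative argument. -/
def psiNonneg (t : ℝ) : ℝ :=
  4 * (Real.exp (t / 2) + Real.exp (-t / 2) - 2)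
    - ∑ n ∈ Finset.Icc 1 ⌊Real.exp t⌋₊,
        ArithmeticFunction.vonMangoldt n / Real.sqrt n * (t - Real.log n)
    + t / 2 * (logDeriv Real.Gamma (1 / 4) - Real.log Real.pi)
    + 1 / 4 * ((Real.pi ^ 2 + 8 * catalan)
        - Real.exp (-t / 2) * hurwitzLerch (Real.exp (-2 * t)) 2 (1 / 4))

/-- The function `Ψ` on the whole line, extended as an even function. -/
def Psi (t : ℝ) : ℝ := psiNonneg |t|

/-- The screw function of the Riemann zeta function, `g = -Ψ`. -/
def screw (t : ℝ) : ℝ := -Psi t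

/-- The kernel `G_g(t,u) = g(t-u) - g(t) - g(-u) + g(0)` of a function `g`. -/
def kernel (g : ℝ → ℝ) (t u : ℝ) : ℝ := g (t - u) - g t - g (-u) + g 0

/-- The integrand of the form attached to `G_g`, as a function of `(t,u)`. -/
def formIntegrand (g : ℝ → ℝ) (φ₁ φ₂ : ℝ → ℂ) (t u : ℝ) : ℂ :=
  (kernel g t u : ℂ) * φ₁ u * (starRingEnd ℂ) (φ₂ t)

/-- The hermitian form `⟨φ₁,φ₂⟩_{G_g,a} = ∫_{-a}^{a} ∫_{-a}^{a} G_g(t,u) φ₁(u) conj(φ₂(t)) du dt`. -/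
def form (g : ℝ → ℝ) (a : ℝ) (φ₁ φ₂ : ℝ → ℂ) : ℂ :=
  ∫ t in (-a)..a, ∫ u in (-a)..a, formIntegrand g φ₁ φ₂ t u

/-- `φ̂(z) = ∫ φ(t) e^{izt} dt` for complex `z`. -/
def hat (φ : ℝ → ℂ) (z : ℂ) : ℂ := ∫ t : ℝ, φ t * Complex.exp (Complex.I * z * t)

/-- `Φ₁(φ,z) = (φ̂(z) - φ̂(0)) / z`. The value at the single point `z = 0` plays no role below. -/
def Phi1 (φ : ℝ → ℂ) (z : ℂ) : ℂ := (hat φ z - hat φ 0) / z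

/-- `L²(-a,a)`, as the square-integrable functions on the line that vanish off `[-a,a]`. -/
def L2 (a : ℝ) : Set (ℝ → ℂ) :=
  {φ | MeasureTheory.MemLp φ 2 MeasureTheory.volume ∧ Function.support φ ⊆ Set.Icc (-a) a}

/-- `K(a)`: restrictions to `[-a,a]` of smooth functions of period `2a`, extended by zero. -/
def K (a : ℝ) : Set (ℝ → ℂ) :=
  {ψ | ∃ h : ℝ → ℂ, ContDiff ℝ ∞ h ∧ Function.Periodic h (2 * a) ∧
    (∀ t, |t| ≤ a → ψ t = h t) ∧ ∀ t, a < |t| → ψ t = 0}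

/-- `K_N(a)`: the elements of `K(a)` whose Fourier coefficients of index `|n| ≤ N` vanish. -/
def KN (N : ℕ) (a : ℝ) : Set (ℝ → ℂ) :=
  {ψ | ψ ∈ K a ∧ ∀ n : ℤ, |n| ≤ (N : ℤ) →
    ∫ x in (-a)..a, ψ x * Complex.exp (Real.pi * Complex.I * n * x / a) = 0}

/-- The primitive `(I_0^{(a)} φ)(t) = ∫_{-a}^t φ(u) du`. -/
def primitive (a : ℝ) (φ : ℝ → ℂ) (t : ℝ) : ℂ := ∫ u in (-a)..t, φ u

/-- The `φ ∈ L²(-a,a)` with `φ̂(0) = 0` and primitive in `K_N(a)`. -/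
def KN0 (N : ℕ) (a : ℝ) : Set (ℝ → ℂ) :=
  {φ | φ ∈ L2 a ∧ hat φ 0 = 0 ∧ primitive a φ ∈ KN N a}

end ZetaScrew

end

/-! Write `f` for the derivative of the primitive `h`, so that `φ = f` a.e. on `[-a,a]` and `h(±a) =
0`. Integration by parts gives `Φ₁(φ,z) = -i ĥ(z)` for `z ≠ 0`, so by Plancherel the right-hand side
is `2πμ‖h‖₂²`. Since `f` has mean zero, only `g(t-u)` survives in the kernel, and the form must be
compared with `‖h‖₂²`.

For `|x| ≤ 2a₀` the function `g` is a finite combination of `e^{±|x|/2}`, kinks `(|x| - log n)₊`,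
`|x|` and a constant, plus the positive series `∑ cₙ⁻² e^{-cₙ|x|}` with `cₙ = 2n + 1/2`. Two
integrations by parts move both derivatives onto the kernel. The finite part then costs at most
`C‖h‖₂²`, with `C` depending only on `a₀` (`convForm_kink_re`, `convForm_exp_re_le`). As
`-(e^{-c|x|})'' = 2cδ₀ - c²e^{-c|x|}`, each term of the series gives `(2/cₙ)‖h‖₂²` minus a smoothing
term (`convForm_exp_re`).

The sum `∑ 2/cₙ` diverges, so finitely many terms outweigh `C + 2πμ`; all later terms are
nonnegative and may be dropped (`sum_le_convForm_tsum`). The smoothing terms of the chosen finite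
set are made small through `N`: if the low Fourier coefficients of `h` vanish, a primitive of `h` is
uniformly small relative to `‖h‖₂` (`exists_norm_sq_primitive_le`). -/

namespace ZetaScrew

open MeasureTheory Complex FourierTransform Set

/-! ### Fourier transform on the line and Plancherel -/

/-- Plancherel's identity for a continuous integrable function with integrable Fourier transform. -/
theorem integral_norm_sq_fourier {f : ℝ → ℂ} (hc : Continuous f) (hi : Integrable f)
    (hfi : Integrable (𝓕 f)) : ∫ ξ, ‖𝓕 f ξ‖ ^ 2 = ∫ x, ‖f x‖ ^ 2 := by
  -- Self-adjointness of the transform, tested against `𝓕 f` itself; Fourier inversion then turns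
  -- the other side into `∫ ‖f‖²`.
  have key := VectorFourier.integral_sesq_fourierIntegral_eq_neg_flip (μ := volume) (ν := volume)
    (L := innerₗ ℝ) (f := f) (g := 𝓕 f) (innerSL ℂ) Real.continuous_fourierChar
    continuous_inner hi hfi
  have inv : ∀ x, VectorFourier.fourierIntegral Real.fourierChar volume (-(innerₗ ℝ).flip)
      (𝓕 f) x = f x := by
    intro x
    have h1 := congrFun (hc.fourierInv_fourier_eq hi hfi) x
    rw [← h1, Real.fourierInv_eq]
    simp [VectorFourier.fourierIntegral]
  simp only [inv] at key
  have e1 : ∀ z : ℂ, innerSL ℂ z z = ((‖z‖ ^ 2 : ℝ) : ℂ) := by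
    intro z
    rw [innerSL_apply_apply, inner_self_eq_norm_sq_to_K]; norm_cast
  have e2 : ∀ ξ, VectorFourier.fourierIntegral Real.fourierChar volume (innerₗ ℝ) f ξ = 𝓕 f ξ :=
    fun ξ => rfl
  simp only [e2, e1] at key
  exact_mod_cast key

theorem hat_ofReal_eq_fourier (φ : ℝ → ℂ) (z : ℝ) :
    hat φ z = 𝓕 φ (-(2 * Real.pi)⁻¹ * z) := by
  rw [hat, Real.fourier_eq']
  congr 1; ext t
  have hp : (Real.pi : ℂ) ≠ 0 := by exact_mod_cast Real.pi_ne_zero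
  rw [smul_eq_mul, mul_comm]
  congr 2
  simp
  field_simp

/-- Lets an element of `L²`, known only up to null sets, be replaced by its smooth representative.
-/
theorem hat_of_ae_eq {a : ℝ} (ha : 0 ≤ a) {φ f : ℝ → ℂ} (hs : ∀ t, a < |t| → φ t = 0)
    (hf : ∀ᵐ t, t ∈ Icc (-a) a → φ t = f t) (z : ℂ) :
    hat φ z = ∫ t in (-a)..a, f t * cexp (I * z * t) := by
  rw [hat, intervalIntegral.integral_of_le (by linarith), ← integral_Icc_eq_integral_Ioc,
    ← setIntegral_eq_integral_of_forall_compl_eq_zero (s := Icc (-a) a)]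
  · refine setIntegral_congr_ae measurableSet_Icc ?_
    filter_upwards [hf] with t ht hm
    rw [ht hm]
  · intro t ht
    rw [hs t, zero_mul]
    by_contra h
    exact ht (abs_le.1 (not_lt.1 h))

theorem integral_deriv_mul_cexp (a : ℝ) {h f : ℝ → ℂ} (hd : ∀ t, HasDerivAt h (f t) t)
    (hf : Continuous f) (z : ℂ) :
    ∫ t in (-a)..a, f t * cexp (z * t) =
      h a * cexp (z * a) - h (-a) * cexp (-(z * a)) - z * ∫ t in (-a)..a, h t * cexp (z * t) := by
  have hh : Continuous h := continuous_iff_continuousAt.2 fun t => (hd t).continuousAt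
  have he : ∀ t : ℝ, HasDerivAt (fun t : ℝ => cexp (z * t)) (z * cexp (z * t)) t := by
    intro t
    have := ((hasDerivAt_id (t : ℂ)).const_mul z).cexp.comp_ofReal
    simpa [mul_comm] using this
  have := intervalIntegral.integral_deriv_mul_eq_sub (a := -a) (b := a) (u := h)
    (v := fun t : ℝ => cexp (z * t)) (fun t _ => hd t) (fun t _ => he t)
    (hf.intervalIntegrable _ _) (Continuous.intervalIntegrable (by fun_prop) _ _)
  rw [intervalIntegral.integral_add (Continuous.intervalIntegrable (by fun_prop) _ _)
    (Continuous.intervalIntegrable (by fun_prop) _ _)] at this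
  have e : ∫ t in (-a)..a, h t * (z * cexp (z * t)) = z * ∫ t in (-a)..a, h t * cexp (z * t) := by
    rw [← intervalIntegral.integral_const_mul]; congr 1; ext t; ring
  rw [e] at this
  push_cast at this
  rw [mul_neg] at this
  linear_combination this

theorem norm_integral_mul_cexp_le {a : ℝ} (ha : 0 ≤ a) (f : ℝ → ℂ) (z : ℝ) :
    ‖∫ t in (-a)..a, f t * cexp (I * z * t)‖ ≤ ∫ t in (-a)..a, ‖f t‖ := by
  refine (intervalIntegral.norm_integral_le_integral_norm (by linarith)).trans_eq ?_
  congr 1; ext t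
  rw [norm_mul, show I * z * t = ((z * t : ℝ) : ℂ) * I by push_cast; ring,
    norm_exp_ofReal_mul_I, mul_one]

/-- A twice differentiable function vanishing at `±a`, cut off to `[-a,a]`, has an integrable
Fourier transform. -/
theorem integrable_hat_cutoff {a : ℝ} (ha : 0 ≤ a) {h f k ψ : ℝ → ℂ}
    (hd : ∀ t, HasDerivAt h (f t) t) (hfd : ∀ t, HasDerivAt f (k t) t) (hk : Continuous k)
    (h0 : h (-a) = 0) (h1 : h a = 0) (hψ : ∀ t, |t| ≤ a → ψ t = h t)
    (hs : ∀ t, a < |t| → ψ t = 0) (hi : Integrable ψ) :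
    Integrable (fun z : ℝ => hat ψ z) := by
  have hf : Continuous f := continuous_iff_continuousAt.2 fun t => (hfd t).continuousAt
  have hh : Continuous h := continuous_iff_continuousAt.2 fun t => (hd t).continuousAt
  set C := ∫ t in (-a)..a, ‖h t‖ with hC
  set D := ‖f a‖ + ‖f (-a)‖ + ∫ t in (-a)..a, ‖k t‖ with hD
  have hat1 : ∀ z : ℝ, hat ψ z = ∫ t in (-a)..a, h t * cexp (I * z * t) := fun z =>
    hat_of_ae_eq ha hs (Filter.Eventually.of_forall fun t ht => hψ t (abs_le.2 ht)) z
  have b1 : ∀ z : ℝ, ‖hat ψ z‖ ≤ C := fun z => by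
    rw [hat1]; exact norm_integral_mul_cexp_le ha h z
  -- Two integrations by parts. The boundary values of `h` vanish but those of `f` need not, so the
  -- decay obtained is `z⁻²`, which suffices for integrability.
  have b2 : ∀ z : ℝ, z ^ 2 * ‖hat ψ z‖ ≤ D := fun z => by
    have e1 := integral_deriv_mul_cexp a hd hf (I * z)
    have e2 := integral_deriv_mul_cexp a hfd hk (I * z)
    rw [h0, h1] at e1
    have e3 : -((z : ℂ) ^ 2 * hat ψ z) = f (-a) * cexp (((-(z * a) : ℝ) : ℂ) * I)
        - f a * cexp (((z * a : ℝ) : ℂ) * I) + ∫ t in (-a)..a, k t * cexp (I * z * t) := by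
      rw [e2, e1, hat1]
      push_cast
      rw [show I * z * (a : ℂ) = z * a * I by ring, show -((z : ℂ) * a) * I = -(z * a * I) by ring]
      linear_combination (z : ℂ) ^ 2 * (∫ t in (-a)..a, h t * cexp (I * z * t)) * (-I_sq)
    have e4 : z ^ 2 * ‖hat ψ z‖ = ‖-((z : ℂ) ^ 2 * hat ψ z)‖ := by simp
    rw [e4, e3]
    refine (norm_add_le _ _).trans ?_
    have := norm_sub_le (f (-a) * cexp (((-(z * a) : ℝ) : ℂ) * I))
      (f a * cexp (((z * a : ℝ) : ℂ) * I))
    rw [norm_mul, norm_mul, norm_exp_ofReal_mul_I, norm_exp_ofReal_mul_I] at this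
    have := norm_integral_mul_cexp_le ha k z
    linarith
  have hm : Continuous (fun z : ℝ => hat ψ z) := by
    simp_rw [hat_ofReal_eq_fourier]
    have : Continuous (𝓕 ψ) := VectorFourier.fourierIntegral_continuous
      Real.continuous_fourierChar continuous_inner hi
    fun_prop
  refine (integrable_inv_one_add_sq.const_mul (C + D)).mono' hm.aestronglyMeasurable ?_
  refine Filter.Eventually.of_forall fun z => ?_
  rw [← div_eq_mul_inv, le_div_iff₀ (by positivity)]
  have := b1 z
  have := b2 z
  nlinarith

/-- The substitution `ξ = -z/(2π)` produces the factor `2π`; square-integrability holds because `hat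
ψ` is both bounded and integrable. -/
theorem integral_norm_sq_hat {ψ : ℝ → ℂ} (hc : Continuous ψ) (hi : Integrable ψ)
    (hh : Integrable (fun z : ℝ => hat ψ z)) :
    Integrable (fun z : ℝ => ‖hat ψ z‖ ^ 2) ∧
      ∫ z : ℝ, ‖hat ψ z‖ ^ 2 = 2 * Real.pi * ∫ t, ‖ψ t‖ ^ 2 := by
  have hp : (-(2 * Real.pi)⁻¹ : ℝ) ≠ 0 := by
    have := Real.pi_pos
    exact neg_ne_zero.2 (inv_ne_zero (by positivity))
  constructor
  · have hm : Continuous (fun z : ℝ => hat ψ z) := by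
      simp_rw [hat_ofReal_eq_fourier]
      have : Continuous (𝓕 ψ) := VectorFourier.fourierIntegral_continuous
        Real.continuous_fourierChar continuous_inner hi
      fun_prop
    refine (hh.norm.const_mul (∫ t, ‖ψ t‖)).mono' (hm.norm.pow 2).aestronglyMeasurable ?_
    refine Filter.Eventually.of_forall fun z => ?_
    have : ‖hat ψ z‖ ≤ ∫ t, ‖ψ t‖ := by
      refine (norm_integral_le_integral_norm _).trans_eq ?_
      congr 1; ext t
      rw [norm_mul, show I * z * t = ((z * t : ℝ) : ℂ) * I by push_cast; ring,
        norm_exp_ofReal_mul_I, mul_one]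
    rw [Real.norm_of_nonneg (by positivity), sq]
    gcongr
  · simp_rw [hat_ofReal_eq_fourier] at hh ⊢
    have hF : Integrable (𝓕 ψ) := (integrable_comp_mul_left_iff _ hp).1 hh
    rw [Measure.integral_comp_mul_left (fun x => ‖𝓕 ψ x‖ ^ 2), integral_norm_sq_fourier hc hi hF]
    have := Real.pi_pos
    rw [inv_neg, inv_inv, abs_neg, abs_of_pos (by positivity), smul_eq_mul]

/-! ### Fourier series on `[-a,a]` and smallness of primitives -/

theorem norm_fourierCoeffOn_primitive {a : ℝ} (ha : -a < a) {h p : ℝ → ℂ}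
    (hp : ∀ t, HasDerivAt p (h t) t) (hh : Continuous h) (h0 : p (-a) = 0) (h1 : p a = 0)
    {n : ℤ} (hn : n ≠ 0) :
    ‖fourierCoeffOn ha p n‖ = a / Real.pi * (|(n : ℝ)|⁻¹ * ‖fourierCoeffOn ha h n‖) := by
  rw [fourierCoeffOn_of_hasDerivAt ha hn (fun x _ => hp x) (hh.intervalIntegrable _ _), h0, h1]
  have ha' : 0 < a := by linarith
  have e : (a : ℂ) - ((-a : ℝ) : ℂ) = ((2 * a : ℝ) : ℂ) := by push_cast; ring
  rw [e, sub_zero, mul_zero, zero_sub, norm_mul, norm_neg, norm_mul, norm_real, norm_div]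
  simp only [norm_mul, norm_neg, norm_real, norm_I, norm_intCast, norm_one, Real.norm_eq_abs]
  rw [abs_of_pos Real.pi_pos, abs_of_pos ha', abs_two]
  have := Real.pi_pos
  have : |(n : ℝ)| ≠ 0 := abs_ne_zero.2 (by exact_mod_cast hn)
  rw [Complex.norm_ofNat]
  field_simp

theorem fourierCoeffOn_eq_zero {a : ℝ} (ha : -a < a) {h : ℝ → ℂ} {n : ℤ}
    (hz : ∫ x in (-a)..a, h x * cexp (Real.pi * I * (-n : ℤ) * x / a) = 0) :
    fourierCoeffOn ha h n = 0 := by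
  have ha' : (a : ℂ) ≠ 0 := by
    have : a ≠ 0 := by linarith
    exact_mod_cast this
  rw [fourierCoeffOn_eq_integral, ← hz]
  convert smul_zero _
  rw [← hz]
  congr 1; ext x
  rw [smul_eq_mul, mul_comm, fourier_coe_apply]
  congr 2
  push_cast
  have : (a : ℂ) - -a = 2 * a := by ring
  rw [this]
  field_simp

/-- A primitive of a function whose Fourier coefficients of index at most `N` vanish is uniformly
small compared with the `L²` norm of the function, when `N` is large. -/
theorem exists_norm_sq_primitive_le {ε : ℝ} (hε : 0 < ε) :
    ∃ N : ℕ, ∀ a : ℝ, 0 < a → ∀ h p : ℝ → ℂ, (∀ t, HasDerivAt p (h t) t) → Continuous h →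
      p (-a) = 0 → (∀ n : ℤ, |n| ≤ (N : ℤ) →
        ∫ x in (-a)..a, h x * cexp (Real.pi * I * n * x / a) = 0) →
      ∀ t ∈ Icc (-a) a, ‖p t‖ ^ 2 ≤ ε * a * ∫ x in (-a)..a, ‖h x‖ ^ 2 := by
  have hsum : Summable fun n : ℤ => 1 / (n : ℝ) ^ 2 := Real.summable_one_div_int_pow.2 one_lt_two
  obtain ⟨s, hs⟩ := summable_iff_vanishing_norm.1 hsum ε hε
  -- `N` is the largest `|n|` in `s`, so any finite set of indices with `|n| > N` avoids `s` and has
  -- `∑ 1/n² < ε`.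
  refine ⟨s.sup Int.natAbs, fun a ha h p hp hh h0 hz t ht => ?_⟩
  set N := s.sup Int.natAbs with hN
  have hab : -a < a := by linarith
  have hpc : Continuous p := continuous_iff_continuousAt.2 fun t => (hp t).continuousAt
  have h1 : p a = 0 := by
    have := intervalIntegral.integral_eq_sub_of_hasDerivAt (a := -a) (b := a) (fun t _ => hp t)
      (hh.intervalIntegrable _ _)
    have h2 := hz 0 (by simp)
    simp only [Int.cast_zero, mul_zero, zero_mul, zero_div, Complex.exp_zero, mul_one] at h2
    rw [h2, h0] at this
    simpa using this.symm
  set d : ℤ → ℂ := fourierCoeffOn hab h with hd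
  have hdz : ∀ n : ℤ, |n| ≤ (N : ℤ) → d n = 0 := fun n hn =>
    fourierCoeffOn_eq_zero hab (hz (-n) (by rwa [abs_neg]))
  have hdsum : HasSum (fun i => ‖d i‖ ^ 2) ((a - (-a))⁻¹ • ∫ x in (-a)..a, ‖h x‖ ^ 2) := by
    refine hasSum_sq_fourierCoeffOn hab ?_
    obtain ⟨B, hB⟩ := isCompact_Icc.exists_bound_of_continuousOn (hh.continuousOn (s := Icc (-a) a))
    refine MemLp.of_bound hh.aestronglyMeasurable B ?_
    exact (ae_restrict_iff' measurableSet_Ioc).2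
      (Filter.Eventually.of_forall fun x hx => hB x (Ioc_subset_Icc_self hx))
  have hcn : ∀ n : ℤ, n ≠ 0 → ‖fourierCoeffOn hab p n‖ = a / Real.pi * (|(n : ℝ)|⁻¹ * ‖d n‖) :=
    fun n hn => norm_fourierCoeffOn_primitive hab hp hh h0 h1 hn
  have hpi := Real.pi_pos
  -- By the inequality of arithmetic and geometric means, `|n|⁻¹‖d n‖` is dominated by `1/n² + ‖d
  -- n‖²`. Summability makes the Fourier series of `p` converge pointwise to `p`.
  have hcs : Summable (fourierCoeffOn hab p) := by
    refine Summable.of_norm_bounded_eventually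
      (g := fun n : ℤ => a / Real.pi * (1 / (n : ℝ) ^ 2 + ‖d n‖ ^ 2))
      ((hsum.add hdsum.summable).mul_left _) ?_
    refine (Set.finite_singleton (0 : ℤ)).subset fun n hn => ?_
    by_contra h0
    refine hn ?_
    show ‖fourierCoeffOn hab p n‖ ≤ _
    rw [hcn n h0]
    gcongr
    have : 1 / (n : ℝ) ^ 2 = (|(n : ℝ)|⁻¹) ^ 2 := by rw [inv_pow, sq_abs, one_div]
    rw [this]
    nlinarith [sq_nonneg (|(n : ℝ)|⁻¹ - ‖d n‖), sq_nonneg (|(n : ℝ)|⁻¹), sq_nonneg ‖d n‖]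
  have : Fact (0 < a - (-a)) := ⟨by linarith⟩
  have hpe : p (-a) = p (-a + (a - (-a))) := by rw [add_sub_cancel, h0, h1]
  let P : C(AddCircle (a - (-a)), ℂ) := ⟨AddCircle.liftIco (a - (-a)) (-a) p,
    AddCircle.liftIco_continuous hpe hpc.continuousOn⟩
  have hPc : fourierCoeff P = fourierCoeffOn hab p := by
    ext n
    rw [fourierCoeffOn_eq_integral, fourierCoeff_eq_intervalIntegral _ _ (-a), add_sub_cancel]
    congr 1
    rw [intervalIntegral.integral_of_le hab.le, intervalIntegral.integral_of_le hab.le,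
      integral_Ioc_eq_integral_Ioo, integral_Ioc_eq_integral_Ioo]
    refine setIntegral_congr_fun measurableSet_Ioo fun x hx => ?_
    simp only [P, ContinuousMap.coe_mk]
    rw [AddCircle.liftIco_coe_apply]
    rw [add_sub_cancel]
    exact Ioo_subset_Ico_self hx
  have hPt : ∀ x ∈ Icc (-a) a, P (x : AddCircle (a - (-a))) = p x := by
    intro x hx
    simp only [P, ContinuousMap.coe_mk]
    rcases eq_or_lt_of_le hx.2 with rfl | hlt
    · have : ((x : ℝ) : AddCircle (x - (-x))) = ((-x : ℝ) : AddCircle (x - (-x))) := by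
        have := AddCircle.coe_add_period (x - (-x)) (-x)
        rwa [add_sub_cancel] at this
      rw [this, AddCircle.liftIco_coe_apply, h0, h1]
      rw [add_sub_cancel]; exact ⟨le_rfl, hab⟩
    · rw [AddCircle.liftIco_coe_apply]
      rw [add_sub_cancel]; exact ⟨hx.1, hlt⟩
  have hser : ∀ x ∈ Icc (-a) a, HasSum (fun i : ℤ => fourierCoeffOn hab p i •
      fourier i (x : AddCircle (a - (-a)))) (p x) := by
    intro x hx
    have := has_pointwise_sum_fourier_series_of_summable (f := P) (by rw [hPc]; exact hcs) x
    rwa [hPc, hPt x hx] at this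
  -- Subtracting the series at `-a`, where `p` vanishes, removes the uncontrolled zeroth coefficient
  -- at the price of a factor `2`.
  have hdiff := (hser t ht).sub (hser (-a) ⟨le_rfl, hab.le⟩)
  rw [h0, sub_zero] at hdiff
  refine le_of_tendsto (hdiff.norm.pow 2) (Filter.Eventually.of_forall fun S => ?_)
  set F := S.filter fun n : ℤ => ¬ |n| ≤ (N : ℤ) with hF
  have hterm : ∀ n ∈ S, ‖fourierCoeffOn hab p n • fourier n (t : AddCircle (a - (-a))) -
      fourierCoeffOn hab p n • fourier n ((-a : ℝ) : AddCircle (a - (-a)))‖ ≤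
      2 * a / Real.pi * (|(n : ℝ)|⁻¹ * ‖d n‖) := by
    intro n _
    by_cases hn : n = 0
    · subst hn; simp
    · refine (norm_sub_le _ _).trans ?_
      rw [norm_smul, norm_smul, fourier_apply, fourier_apply, Circle.norm_coe, Circle.norm_coe,
        hcn n hn]
      apply le_of_eq; ring
  have hS : ‖∑ n ∈ S, (fourierCoeffOn hab p n • fourier n (t : AddCircle (a - (-a))) -
      fourierCoeffOn hab p n • fourier n ((-a : ℝ) : AddCircle (a - (-a))))‖ ≤
      2 * a / Real.pi * ∑ n ∈ F, |(n : ℝ)|⁻¹ * ‖d n‖ := by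
    refine (norm_sum_le_of_le _ hterm).trans_eq ?_
    rw [← Finset.mul_sum, hF, Finset.sum_filter]
    congr 1
    refine Finset.sum_congr rfl fun n _ => ?_
    split_ifs with hn
    · rw [hdz n hn]; simp
    · rfl
  have hCS := Finset.sum_mul_sq_le_sq_mul_sq F (fun n : ℤ => |(n : ℝ)|⁻¹) (fun n => ‖d n‖)
  have hT : ∑ n ∈ F, (|(n : ℝ)|⁻¹) ^ 2 ≤ ε := by
    have := hs F (by
      rw [Finset.disjoint_left]
      intro n hn hns
      have h2 : n.natAbs ≤ N := Finset.le_sup (f := Int.natAbs) hns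
      have h3 := (Finset.mem_filter.1 hn).2
      rw [← Int.natCast_natAbs] at h3
      omega)
    refine le_trans (le_of_eq ?_) ((le_abs_self _).trans this.le)
    refine Finset.sum_congr rfl fun n _ => ?_
    rw [inv_pow, sq_abs, one_div]
  have hD : ∑ n ∈ F, ‖d n‖ ^ 2 ≤ (2 * a)⁻¹ * ∫ x in (-a)..a, ‖h x‖ ^ 2 := by
    have := sum_le_hasSum F (fun n _ => sq_nonneg ‖d n‖) hdsum
    rwa [smul_eq_mul, show a - (-a) = 2 * a by ring] at this
  set A := ∫ x in (-a)..a, ‖h x‖ ^ 2 with hA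
  have hA0 : 0 ≤ A := intervalIntegral.integral_nonneg hab.le fun x _ => by positivity
  calc _ ≤ (2 * a / Real.pi * ∑ n ∈ F, |(n : ℝ)|⁻¹ * ‖d n‖) ^ 2 := by gcongr
    _ ≤ (2 * a / Real.pi) ^ 2 * (ε * ((2 * a)⁻¹ * A)) := by
        rw [mul_pow]
        gcongr
        refine hCS.trans ?_
        gcongr
    _ = (2 / Real.pi ^ 2) * (ε * a * A) := by field_simp
    _ ≤ 1 * (ε * a * A) := by
        gcongr
        rw [div_le_one (by positivity)]
        nlinarith [Real.pi_gt_three]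
    _ = _ := one_mul _

/-! ### Convolution forms: symmetry, linearity, crude bounds -/

/-- The form `∫∫ k(t-u) f(u) conj(f(t)) du dt` over `[-a,a]²`. -/
noncomputable def convForm (a : ℝ) (f : ℝ → ℂ) (k : ℝ → ℝ) : ℂ :=
  ∫ t in (-a)..a, ∫ u in (-a)..a, (k (t - u) : ℂ) * f u * (starRingEnd ℂ) (f t)

/-- The part of `convForm` below the diagonal. -/
noncomputable def causalForm (a : ℝ) (f : ℝ → ℂ) (k : ℝ → ℝ) : ℂ :=
  ∫ t in (-a)..a, (starRingEnd ℂ) (f t) * ∫ u in (-a)..t, (k (t - u) : ℂ) * f u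

/-- A function `h` vanishing at `±a` together with its continuous derivative `f`. -/
structure DirichletPair (a : ℝ) (h f : ℝ → ℂ) : Prop where
  pos : 0 < a
  deriv : ∀ t, HasDerivAt h (f t) t
  cont : Continuous f
  left : h (-a) = 0
  right : h a = 0

theorem DirichletPair.cont_h {a : ℝ} {h f : ℝ → ℂ} (H : DirichletPair a h f) : Continuous h :=
  continuous_iff_continuousAt.2 fun t => (H.deriv t).continuousAt

theorem integral_integral_triangle_swap {a : ℝ} (ha : 0 < a) {k : ℝ → ℝ → ℂ}
    (hk : Continuous (Function.uncurry k)) :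
    ∫ t in (-a)..a, ∫ u in t..a, k t u = ∫ u in (-a)..a, ∫ t in (-a)..u, k t u := by
  have hab : -a ≤ a := by linarith
  set s : Set (ℝ × ℝ) := {p | p.1 < p.2} with hs
  have hsm : MeasurableSet s := measurableSet_lt measurable_fst measurable_snd
  set F : ℝ → ℝ → ℂ := fun t u => s.indicator (Function.uncurry k) (t, u) with hF
  have hint : IntegrableOn (Function.uncurry F) (uIoc (-a) a ×ˢ uIoc (-a) a) := by
    have h1 : IntegrableOn (Function.uncurry k) (Icc (-a) a ×ˢ Icc (-a) a) :=
      hk.continuousOn.integrableOn_compact (isCompact_Icc.prod isCompact_Icc)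
    have h2 : IntegrableOn (Function.uncurry k) (uIoc (-a) a ×ˢ uIoc (-a) a) := by
      rw [uIoc_of_le hab]
      exact h1.mono_set (prod_mono Ioc_subset_Icc_self Ioc_subset_Icc_self)
    exact h2.indicator hsm
  have key := intervalIntegral_intervalIntegral_swap (F := F) hint
  convert key using 1
  · refine intervalIntegral.integral_congr fun t ht => ?_
    rw [uIcc_of_le hab] at ht
    rw [intervalIntegral.integral_of_le ht.2, intervalIntegral.integral_of_le hab]
    have : (fun u => F t u) = (Ioi t).indicator (fun u => k t u) := by
      ext u
      simp only [hF, indicator, hs, mem_ofPred_eq, mem_Ioi]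
      rfl
    rw [this, setIntegral_indicator measurableSet_Ioi, Ioc_inter_Ioi, max_eq_right ht.1]
  · refine intervalIntegral.integral_congr fun u hu => ?_
    rw [uIcc_of_le hab] at hu
    rw [intervalIntegral.integral_of_le hu.1, intervalIntegral.integral_of_le hab]
    have : (fun t => F t u) = (Iio u).indicator (fun t => k t u) := by
      ext t
      simp only [hF, indicator, hs, mem_ofPred_eq, mem_Iio]
      rfl
    rw [this, setIntegral_indicator measurableSet_Iio, integral_Ioc_eq_integral_Ioo]
    congr 2
    ext x
    simp only [mem_Ioo, mem_inter_iff, mem_Ioc, mem_Iio]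
    constructor
    · rintro ⟨h1, h2⟩; exact ⟨⟨h1, h2.le.trans hu.2⟩, h2⟩
    · rintro ⟨⟨h1, _⟩, h2⟩; exact ⟨h1, h2⟩

theorem continuous_parametric_integral {k : ℝ → ℝ → ℂ} (hk : Continuous (Function.uncurry k))
    (b : ℝ) : Continuous fun t => ∫ u in b..t, k t u :=
  intervalIntegral.continuous_parametric_intervalIntegral_of_continuous (a₀ := b) hk continuous_id

/-- Since `k` is real and even, exchanging `t` and `u` carries the half above the diagonal to the
conjugate of the half below. -/
theorem convForm_eq_causalForm {a : ℝ} (ha : 0 < a) {f : ℝ → ℂ} (hf : Continuous f) {k : ℝ → ℝ}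
    (hk : Continuous k) (he : ∀ x, k (-x) = k x) :
    convForm a f k = causalForm a f k + (starRingEnd ℂ) (causalForm a f k) := by
  have hc : Continuous (starRingEnd ℂ) := continuous_conj
  have h1 : ∀ t, ∫ u in (-a)..a, (k (t - u) : ℂ) * f u * (starRingEnd ℂ) (f t) =
      (starRingEnd ℂ) (f t) * (∫ u in (-a)..t, (k (t - u) : ℂ) * f u) +
      ∫ u in t..a, (k (t - u) : ℂ) * f u * (starRingEnd ℂ) (f t) := by
    intro t
    rw [← intervalIntegral.integral_add_adjacent_intervals (b := t)
      (Continuous.intervalIntegrable (by fun_prop) _ _)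
      (Continuous.intervalIntegrable (by fun_prop) _ _), intervalIntegral.integral_mul_const,
      mul_comm]
  have hcont1 : Continuous fun t => ∫ u in (-a)..t, (k (t - u) : ℂ) * f u :=
    continuous_parametric_integral (k := fun t u => (k (t - u) : ℂ) * f u) (by fun_prop) (-a)
  have hcont2 : Continuous fun t => ∫ u in t..a, (k (t - u) : ℂ) * f u * (starRingEnd ℂ) (f t) := by
    have := continuous_parametric_integral
      (k := fun t u => (k (t - u) : ℂ) * f u * (starRingEnd ℂ) (f t)) (by fun_prop) a
    have h := this.neg
    simp_rw [intervalIntegral.integral_symm a]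
    exact h
  unfold convForm
  simp_rw [h1]
  rw [intervalIntegral.integral_add (Continuous.intervalIntegrable (by fun_prop) _ _)
    (hcont2.intervalIntegrable _ _)]
  congr 1
  rw [integral_integral_triangle_swap ha
    (k := fun t u => (k (t - u) : ℂ) * f u * (starRingEnd ℂ) (f t)) (by fun_prop)]
  unfold causalForm
  rw [intervalIntegral, intervalIntegral, map_sub, ← integral_conj, ← integral_conj,
    ← intervalIntegral, ← intervalIntegral]
  refine intervalIntegral.integral_congr fun u _ => ?_
  simp only [map_mul, conj_conj]
  rw [intervalIntegral, intervalIntegral, map_sub, ← integral_conj, ← integral_conj,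
    ← intervalIntegral, ← intervalIntegral, ← intervalIntegral.integral_const_mul]
  refine intervalIntegral.integral_congr fun t _ => ?_
  simp only [map_mul, conj_ofReal]
  rw [← he (t - u), neg_sub]
  ring

theorem convForm_im {a : ℝ} (ha : 0 < a) {f : ℝ → ℂ} (hf : Continuous f) {k : ℝ → ℝ}
    (hk : Continuous k) (he : ∀ x, k (-x) = k x) : (convForm a f k).im = 0 := by
  rw [convForm_eq_causalForm ha hf hk he]; simp

theorem convForm_re {a : ℝ} (ha : 0 < a) {f : ℝ → ℂ} (hf : Continuous f) {k : ℝ → ℝ}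
    (hk : Continuous k) (he : ∀ x, k (-x) = k x) :
    (convForm a f k).re = 2 * (causalForm a f k).re := by
  rw [convForm_eq_causalForm ha hf hk he]; simp; ring

theorem continuous_convForm_inner (a : ℝ) {f : ℝ → ℂ} (hf : Continuous f) {k : ℝ → ℝ}
    (hk : Continuous k) : Continuous fun t =>
      ∫ u in (-a)..a, (k (t - u) : ℂ) * f u * (starRingEnd ℂ) (f t) := by
  have hc : Continuous (starRingEnd ℂ) := continuous_conj
  exact intervalIntegral.continuous_parametric_intervalIntegral_of_continuous' (by fun_prop) _ _

theorem convForm_add (a : ℝ) {f : ℝ → ℂ} (hf : Continuous f) {k l : ℝ → ℝ}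
    (hk : Continuous k) (hl : Continuous l) :
    convForm a f (fun x => k x + l x) = convForm a f k + convForm a f l := by
  have hc : Continuous (starRingEnd ℂ) := continuous_conj
  unfold convForm
  rw [← intervalIntegral.integral_add
    ((continuous_convForm_inner a hf hk).intervalIntegrable _ _)
    ((continuous_convForm_inner a hf hl).intervalIntegrable _ _)]
  refine intervalIntegral.integral_congr fun t _ => ?_
  simp only
  rw [← intervalIntegral.integral_add (Continuous.intervalIntegrable (by fun_prop) _ _)
      (Continuous.intervalIntegrable (by fun_prop) _ _)]
  refine intervalIntegral.integral_congr fun u _ => ?_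
  push_cast; ring

theorem convForm_const_mul (a : ℝ) (f : ℝ → ℂ) (c : ℝ) (k : ℝ → ℝ) :
    convForm a f (fun x => c * k x) = c * convForm a f k := by
  unfold convForm
  rw [← intervalIntegral.integral_const_mul]
  refine intervalIntegral.integral_congr fun t _ => ?_
  simp only
  rw [← intervalIntegral.integral_const_mul]
  refine intervalIntegral.integral_congr fun u _ => ?_
  push_cast; ring

theorem convForm_sum (a : ℝ) {f : ℝ → ℂ} (hf : Continuous f) {ι : Type*} (s : Finset ι)
    {k : ι → ℝ → ℝ} (hk : ∀ i, Continuous (k i)) :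
    convForm a f (fun x => ∑ i ∈ s, k i x) = ∑ i ∈ s, convForm a f (k i) := by
  classical
  induction s using Finset.induction_on with
  | empty => simp [convForm]
  | insert i s hi ih =>
    simp_rw [Finset.sum_insert hi]
    rw [convForm_add a hf (hk i) (continuous_finsetSum _ fun j _ => hk j), ih]

theorem DirichletPair.integral_eq_zero {a : ℝ} {h f : ℝ → ℂ} (H : DirichletPair a h f) :
    ∫ u in (-a)..a, f u = 0 := by
  rw [intervalIntegral.integral_eq_sub_of_hasDerivAt (fun t _ => H.deriv t)
    (H.cont.intervalIntegrable _ _), H.left, H.right, sub_zero]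

theorem DirichletPair.convForm_const {a : ℝ} {h f : ℝ → ℂ} (H : DirichletPair a h f) (c : ℝ) :
    convForm a f (fun _ => c) = 0 := by
  unfold convForm
  simp [intervalIntegral.integral_mul_const, intervalIntegral.integral_const_mul,
    H.integral_eq_zero]

/-- This bound sees the supremum of `f`, not `‖h‖₂`; it serves only to send tails of the exponential
series to zero for a fixed `f`. -/
theorem norm_convForm_le {a B C : ℝ} (ha : 0 < a) {f : ℝ → ℂ} {k : ℝ → ℝ}
    (hB : ∀ t ∈ Icc (-a) a, ‖f t‖ ≤ B) (hC : ∀ x, |k x| ≤ C) :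
    ‖convForm a f k‖ ≤ C * (B * B * (2 * a) ^ 2) := by
  have hB0 : 0 ≤ B := (norm_nonneg _).trans (hB 0 ⟨by linarith, by linarith⟩)
  have hC0 : 0 ≤ C := (abs_nonneg _).trans (hC 0)
  have hab : -a ≤ a := by linarith
  have h1 : ∀ t ∈ uIoc (-a) a, ‖∫ u in (-a)..a, (k (t - u) : ℂ) * f u * (starRingEnd ℂ) (f t)‖ ≤
      C * B * B * |a - -a| := by
    intro t ht
    rw [uIoc_of_le hab] at ht
    refine intervalIntegral.norm_integral_le_of_norm_le_const fun u hu => ?_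
    rw [uIoc_of_le hab] at hu
    rw [norm_mul, norm_mul, norm_real, RCLike.norm_conj]
    have := hB t (Ioc_subset_Icc_self ht)
    have := hB u (Ioc_subset_Icc_self hu)
    have := hC (t - u)
    rw [← Real.norm_eq_abs] at this
    gcongr
  refine (intervalIntegral.norm_integral_le_of_norm_le_const h1).trans_eq ?_
  rw [abs_of_nonneg (by linarith)]
  ring

/-! ### Exponential and kink kernels -/

theorem hasDerivAt_cexp_mul (c : ℝ) (t : ℝ) :
    HasDerivAt (fun t : ℝ => cexp (c * t)) (c * cexp (c * t)) t := by
  have := ((hasDerivAt_id (t : ℂ)).const_mul (c : ℂ)).cexp.comp_ofReal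
  simpa [mul_comm] using this

theorem HasDerivAt.conj_complex {h : ℝ → ℂ} {f : ℂ} {t : ℝ} (H : HasDerivAt h f t) :
    HasDerivAt (fun t => (starRingEnd ℂ) (h t)) ((starRingEnd ℂ) f) t := by
  simpa using H.star

/-- `∫_{-a}^t e^{-c(t-u)} h(u) du`. -/
noncomputable def expConv (a c : ℝ) (h : ℝ → ℂ) (t : ℝ) : ℂ :=
  cexp ((-c : ℝ) * t) * ∫ u in (-a)..t, cexp (c * u) * h u

theorem hasDerivAt_expConv (a c : ℝ) {h : ℝ → ℂ} (hh : Continuous h) (t : ℝ) :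
    HasDerivAt (expConv a c h) (h t - c * expConv a c h t) t := by
  have hc : Continuous fun u : ℝ => cexp (c * u) * h u := by fun_prop
  have h1 := intervalIntegral.integral_hasDerivAt_right (hc.intervalIntegrable (-a) t)
    (hc.stronglyMeasurableAtFilter _ _) hc.continuousAt
  have h2 := (hasDerivAt_cexp_mul (-c) t).mul h1
  refine h2.congr_deriv ?_
  unfold expConv
  have : cexp ((-c : ℝ) * t) * (cexp (c * t) * h t) = h t := by
    rw [← mul_assoc, ← Complex.exp_add]; simp
  rw [this]
  push_cast; ring

theorem continuous_expConv (a c : ℝ) {h : ℝ → ℂ} (hh : Continuous h) :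
    Continuous (expConv a c h) :=
  continuous_iff_continuousAt.2 fun t => (hasDerivAt_expConv a c hh t).continuousAt

theorem expConv_eq_integral (a c : ℝ) (h : ℝ → ℂ) (t : ℝ) :
    expConv a c h t = ∫ u in (-a)..t, (Real.exp (-c * (t - u)) : ℂ) * h u := by
  unfold expConv
  rw [← intervalIntegral.integral_const_mul]
  refine intervalIntegral.integral_congr fun u _ => ?_
  rw [← mul_assoc, ← Complex.exp_add]
  push_cast
  congr 2; ring

theorem DirichletPair.expConv_deriv {a : ℝ} {h f : ℝ → ℂ} (H : DirichletPair a h f) (c t : ℝ) :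
    expConv a c f t = h t - c * expConv a c h t := by
  have e : ∀ u ∈ uIcc (-a) t, HasDerivAt (fun u : ℝ => cexp (c * u) * h u)
      (c * cexp (c * u) * h u + cexp (c * u) * f u) u := fun u _ =>
    (hasDerivAt_cexp_mul c u).mul (H.deriv u)
  have hf := H.cont
  have hh := H.cont_h
  have h1 := intervalIntegral.integral_eq_sub_of_hasDerivAt e
    (Continuous.intervalIntegrable (by fun_prop) _ _)
  rw [intervalIntegral.integral_add (Continuous.intervalIntegrable (by fun_prop) _ _)
    (Continuous.intervalIntegrable (by fun_prop) _ _), H.left, mul_zero, sub_zero] at h1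
  simp_rw [mul_assoc] at h1
  rw [intervalIntegral.integral_const_mul] at h1
  unfold expConv
  have h2 : cexp ((-c : ℝ) * t) * (cexp (c * t) * h t) = h t := by
    rw [← mul_assoc, ← Complex.exp_add]; simp
  linear_combination cexp ((-c : ℝ) * t) * h1 + h2

theorem causalForm_exp {a : ℝ} (ha : 0 < a) (c : ℝ) (f : ℝ → ℂ) :
    causalForm a f (fun x => Real.exp (-c * |x|)) =
      ∫ t in (-a)..a, (starRingEnd ℂ) (f t) * expConv a c f t := by
  refine intervalIntegral.integral_congr fun t ht => ?_
  rw [uIcc_of_le (by linarith)] at ht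
  rw [expConv_eq_integral]
  congr 1
  refine intervalIntegral.integral_congr fun u hu => ?_
  rw [uIcc_of_le ht.1] at hu
  simp only
  rw [abs_of_nonneg (sub_nonneg.2 hu.2)]

/-- Integration by parts against the conjugate of the derivative. -/
theorem DirichletPair.integral_conj_deriv_mul {a : ℝ} {h f : ℝ → ℂ} (H : DirichletPair a h f)
    {G g : ℝ → ℂ} (hG : ∀ t, HasDerivAt G (g t) t) (hg : Continuous g) :
    ∫ t in (-a)..a, (starRingEnd ℂ) (f t) * G t = -∫ t in (-a)..a, (starRingEnd ℂ) (h t) * g t := by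
  have hc : Continuous (starRingEnd ℂ) := continuous_conj
  have hf := H.cont
  have hh := H.cont_h
  have hGc : Continuous G := continuous_iff_continuousAt.2 fun t => (hG t).continuousAt
  have := intervalIntegral.integral_deriv_mul_eq_sub (a := -a) (b := a)
    (fun t _ => HasDerivAt.conj_complex (H.deriv t)) (fun t _ => hG t)
    (Continuous.intervalIntegrable (by fun_prop) _ _) (hg.intervalIntegrable _ _)
  rw [intervalIntegral.integral_add (Continuous.intervalIntegrable (by fun_prop) _ _)
    (Continuous.intervalIntegrable (by fun_prop) _ _), H.left, H.right] at this
  simp only [map_zero, zero_mul, sub_zero] at this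
  linear_combination this

theorem conj_mul_self_eq (z : ℂ) : (starRingEnd ℂ) z * z = ((‖z‖ ^ 2 : ℝ) : ℂ) := by
  rw [mul_comm, mul_conj, normSq_eq_norm_sq]

/-- The identity `-(e^{-c|x|})'' = 2cδ₀ - c²e^{-c|x|}` in integrated form. No sign of `c` is needed,
so it also covers the growing exponential `e^{|x|/2}`. -/
theorem DirichletPair.convForm_exp_re {a : ℝ} {h f : ℝ → ℂ} (H : DirichletPair a h f) (c : ℝ) :
    (convForm a f (fun x => Real.exp (-c * |x|))).re = 2 * c * (∫ t in (-a)..a, ‖h t‖ ^ 2) -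
      2 * c ^ 2 * (∫ t in (-a)..a, (starRingEnd ℂ) (h t) * expConv a c h t).re := by
  have hc : Continuous (starRingEnd ℂ) := continuous_conj
  have hf := H.cont
  have hh := H.cont_h
  have hE := continuous_expConv a c hh
  rw [convForm_re H.pos hf (by fun_prop) (fun x => by rw [abs_neg]), causalForm_exp H.pos]
  simp_rw [H.expConv_deriv, mul_sub]
  rw [intervalIntegral.integral_sub (Continuous.intervalIntegrable (by fun_prop) _ _)
    (Continuous.intervalIntegrable (by fun_prop) _ _)]
  -- Here `∫ conj f · h` equals minus its own conjugate, so its real part vanishes.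
  have e1 := H.integral_conj_deriv_mul H.deriv hf
  have e1' : (∫ t in (-a)..a, (starRingEnd ℂ) (f t) * h t).re = 0 := by
    have e : ∫ t in (-a)..a, (starRingEnd ℂ) (h t) * f t =
        (starRingEnd ℂ) (∫ t in (-a)..a, (starRingEnd ℂ) (f t) * h t) := by
      rw [intervalIntegral, intervalIntegral, map_sub, ← integral_conj, ← integral_conj]
      simp_rw [map_mul, conj_conj, mul_comm]
    rw [e] at e1
    have := congrArg Complex.re e1
    simp only [neg_re, conj_re] at this
    linarith
  have e2 := H.integral_conj_deriv_mul (fun t => hasDerivAt_expConv a c hh t) (by fun_prop)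
  have e3 : ∫ t in (-a)..a, (starRingEnd ℂ) (f t) * (c * expConv a c h t) =
      c * ∫ t in (-a)..a, (starRingEnd ℂ) (f t) * expConv a c h t := by
    rw [← intervalIntegral.integral_const_mul]; congr 1; ext t; ring
  have e4 : ∫ t in (-a)..a, (starRingEnd ℂ) (h t) * (h t - c * expConv a c h t) =
      ((∫ t in (-a)..a, ‖h t‖ ^ 2 : ℝ) : ℂ) -
        c * ∫ t in (-a)..a, (starRingEnd ℂ) (h t) * expConv a c h t := by
    rw [← intervalIntegral.integral_const_mul, ← intervalIntegral.integral_ofReal,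
      ← intervalIntegral.integral_sub (Continuous.intervalIntegrable (by fun_prop) _ _)
      (Continuous.intervalIntegrable (by fun_prop) _ _)]
    congr 1; ext t
    rw [← conj_mul_self_eq]; ring
  rw [e3, e2, e4, sub_re, e1', re_ofReal_mul, neg_re, sub_re, ofReal_re, re_ofReal_mul]
  ring

/-- Positive definiteness of `e^{-c|x|}` through an energy identity: `E' = f - cE` and `E(-a) = 0`
give `2 Re ∫ conj f · E = ‖E(a)‖² + 2c ∫ ‖E‖²`. -/
theorem DirichletPair.convForm_exp_nonneg {a : ℝ} {h f : ℝ → ℂ} (H : DirichletPair a h f)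
    {c : ℝ} (hc0 : 0 ≤ c) : 0 ≤ (convForm a f (fun x => Real.exp (-c * |x|))).re := by
  have hc : Continuous (starRingEnd ℂ) := continuous_conj
  have hf := H.cont
  have ha := H.pos
  rw [convForm_re H.pos hf (by fun_prop) (fun x => by rw [abs_neg]), causalForm_exp H.pos]
  set E := expConv a c f with hEdef
  have hE : Continuous E := continuous_expConv a c hf
  have hd : ∀ t, HasDerivAt (fun t => ‖E t‖ ^ 2)
      (2 * ((starRingEnd ℂ) (f t) * E t).re - 2 * c * ‖E t‖ ^ 2) t := by
    intro t
    have := (hasDerivAt_expConv a c hf t).norm_sq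
    refine this.congr_deriv ?_
    rw [Complex.inner, ← hEdef, ← normSq_eq_norm_sq, normSq_apply]
    simp
    ring
  have hint := intervalIntegral.integral_eq_sub_of_hasDerivAt (a := -a) (b := a) (fun t _ => hd t)
    (Continuous.intervalIntegrable (by fun_prop) _ _)
  rw [intervalIntegral.integral_sub (Continuous.intervalIntegrable (by fun_prop) _ _)
    (Continuous.intervalIntegrable (by fun_prop) _ _), intervalIntegral.integral_const_mul,
    intervalIntegral.integral_const_mul] at hint
  have hE0 : E (-a) = 0 := by simp [hEdef, expConv]
  have hre : ∫ t in (-a)..a, ((starRingEnd ℂ) (f t) * E t).re =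
      (∫ t in (-a)..a, (starRingEnd ℂ) (f t) * E t).re := by
    have := (reCLM).intervalIntegral_comp_comm (μ := volume) (a := -a) (b := a)
      (f := fun t => (starRingEnd ℂ) (f t) * E t)
      (Continuous.intervalIntegrable (by fun_prop) _ _)
    simpa using this
  rw [hE0, hre] at hint
  have hn : 0 ≤ ∫ t in (-a)..a, ‖E t‖ ^ 2 :=
    intervalIntegral.integral_nonneg (by linarith) fun t _ => by positivity
  have := mul_nonneg hc0 hn
  have : 0 ≤ ‖E a‖ ^ 2 := by positivity
  simp at hint
  linarith

/-- The second derivative of `(|x| - l)₊` is `δ_l + δ_{-l}`, so the form is `-2 Re ∫ conj h(t) ·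
h(t-l)`, a correlation of `h` with its translate. -/
theorem DirichletPair.convForm_kink_re {a : ℝ} {h f : ℝ → ℂ} (H : DirichletPair a h f)
    {l : ℝ} (hl : 0 ≤ l) :
    |(convForm a f (fun x => max 0 (|x| - l))).re| ≤ 2 * ∫ t in (-a)..a, ‖h t‖ ^ 2 := by
  have hc : Continuous (starRingEnd ℂ) := continuous_conj
  have hf := H.cont
  have hh := H.cont_h
  have ha := H.pos
  rw [convForm_re H.pos hf (by fun_prop) (fun x => by rw [abs_neg])]
  -- Since `h(-a) = 0`, clamping the argument extends `h` continuously by zero to the left; `t - l ≤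
  -- a` makes a cutoff on the right unnecessary.
  set m : ℝ → ℂ := fun s => h (max (-a) s) with hm
  have hmc : Continuous m := by fun_prop
  set q : ℝ → ℂ := fun s => ∫ u in (-a)..s, m u with hq
  have hqd : ∀ s, HasDerivAt q (m s) s := fun s =>
    intervalIntegral.integral_hasDerivAt_right (hmc.intervalIntegrable (-a) s)
      (hmc.stronglyMeasurableAtFilter _ _) hmc.continuousAt
  have hm0 : ∀ s ≤ -a, m s = 0 := fun s hs => by simp only [hm]; rw [max_eq_left hs, H.left]
  have hinner : ∀ t ∈ Icc (-a) a,
      ∫ u in (-a)..t, ((max 0 (|t - u| - l) : ℝ) : ℂ) * f u = q (t - l) := by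
    intro t ht
    have hcont : Continuous fun u => ((max 0 (|t - u| - l) : ℝ) : ℂ) * f u := by fun_prop
    rcases le_total (t - l) (-a) with h1 | h1
    · have e1 : q (t - l) = 0 := by
        simp only [hq]
        rw [intervalIntegral.integral_symm, neg_eq_zero]
        refine intervalIntegral.integral_zero_ae (Filter.Eventually.of_forall fun u hu => ?_)
        rw [uIoc_of_le h1] at hu
        exact hm0 u hu.2
      rw [e1]
      refine intervalIntegral.integral_zero_ae (Filter.Eventually.of_forall fun u hu => ?_)
      rw [uIoc_of_le ht.1] at hu
      rw [abs_of_nonneg (by linarith [hu.2]), max_eq_left (by linarith [hu.1])]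
      simp
    · rw [← intervalIntegral.integral_add_adjacent_intervals (b := t - l)
        (hcont.intervalIntegrable _ _) (hcont.intervalIntegrable _ _)]
      have e2 : ∫ u in (t - l)..t, ((max 0 (|t - u| - l) : ℝ) : ℂ) * f u = 0 := by
        refine intervalIntegral.integral_zero_ae (Filter.Eventually.of_forall fun u hu => ?_)
        rw [uIoc_of_le (by linarith)] at hu
        rw [abs_of_nonneg (by linarith [hu.2]), max_eq_left (by linarith [hu.1])]
        simp
      have e3 : ∫ u in (-a)..(t - l), ((max 0 (|t - u| - l) : ℝ) : ℂ) * f u =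
          ∫ u in (-a)..(t - l), ((t - l - u : ℝ) : ℂ) * f u := by
        refine intervalIntegral.integral_congr fun u hu => ?_
        rw [uIcc_of_le h1] at hu
        rw [abs_of_nonneg (by linarith [hu.2]), max_eq_right (by linarith [hu.2])]
        congr 2; ring
      have hld : ∀ u : ℝ, HasDerivAt (fun u : ℝ => ((t - l - u : ℝ) : ℂ)) (-1) u := by
        intro u
        simpa using ((hasDerivAt_id u).const_sub (t - l)).ofReal_comp
      have e4 := intervalIntegral.integral_deriv_mul_eq_sub (a := -a) (b := t - l)
        (fun u _ => hld u) (fun u _ => H.deriv u) (continuous_const.intervalIntegrable _ _)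
        (hf.intervalIntegrable _ _)
      rw [intervalIntegral.integral_add (Continuous.intervalIntegrable (by fun_prop) _ _)
        (Continuous.intervalIntegrable (by fun_prop) _ _), H.left,
        intervalIntegral.integral_const_mul] at e4
      have e5 : q (t - l) = ∫ u in (-a)..(t - l), h u := by
        refine intervalIntegral.integral_congr fun u hu => ?_
        rw [uIcc_of_le h1] at hu
        simp only [hm]
        rw [max_eq_right hu.1]
      rw [e2, e3, e5]
      simp only [sub_self, ofReal_zero, zero_mul, mul_zero] at e4
      linear_combination e4
  have hcausal : causalForm a f (fun x => max 0 (|x| - l)) =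
      -∫ t in (-a)..a, (starRingEnd ℂ) (h t) * m (t - l) := by
    rw [← H.integral_conj_deriv_mul (G := fun t => q (t - l))
      (fun t => (hqd (t - l)).comp_sub_const t l) (by fun_prop)]
    refine intervalIntegral.integral_congr fun t ht => ?_
    rw [uIcc_of_le (by linarith)] at ht
    simp only
    rw [hinner t ht]
  have hA : ∫ t in (-a)..a, ‖m (t - l)‖ ^ 2 ≤ ∫ t in (-a)..a, ‖h t‖ ^ 2 := by
    rw [intervalIntegral.integral_comp_sub_right (fun s => ‖m s‖ ^ 2)]
    have hmi : Continuous fun s => ‖m s‖ ^ 2 := by fun_prop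
    calc _ ≤ ∫ s in (-a - l)..a, ‖m s‖ ^ 2 := by
          refine intervalIntegral.integral_mono_interval le_rfl (by linarith) (by linarith)
            (Filter.Eventually.of_forall fun s => by positivity) (hmi.intervalIntegrable _ _)
      _ = (∫ s in (-a - l)..(-a), ‖m s‖ ^ 2) + ∫ s in (-a)..a, ‖m s‖ ^ 2 :=
          (intervalIntegral.integral_add_adjacent_intervals (hmi.intervalIntegrable _ _)
            (hmi.intervalIntegrable _ _)).symm
      _ = 0 + ∫ t in (-a)..a, ‖h t‖ ^ 2 := by
          congr 1
          · refine intervalIntegral.integral_zero_ae (Filter.Eventually.of_forall fun u hu => ?_)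
            rw [uIoc_of_le (by linarith)] at hu
            rw [hm0 u hu.2]; simp
          · refine intervalIntegral.integral_congr fun u hu => ?_
            rw [uIcc_of_le (by linarith)] at hu
            simp only [hm]
            rw [max_eq_right hu.1]
      _ = _ := zero_add _
  rw [hcausal]
  have hb : ‖∫ t in (-a)..a, (starRingEnd ℂ) (h t) * m (t - l)‖ ≤
      ∫ t in (-a)..a, ((1 / 2) * ‖h t‖ ^ 2 + (1 / 2) * ‖m (t - l)‖ ^ 2) := by
    refine intervalIntegral.norm_integral_le_of_norm_le (by linarith)
      (Filter.Eventually.of_forall fun t _ => ?_) (Continuous.intervalIntegrable (by fun_prop) _ _)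
    rw [norm_mul, RCLike.norm_conj]
    nlinarith [sq_nonneg (‖h t‖ - ‖m (t - l)‖)]
  rw [intervalIntegral.integral_add (Continuous.intervalIntegrable (by fun_prop) _ _)
    (Continuous.intervalIntegrable (by fun_prop) _ _), intervalIntegral.integral_const_mul,
    intervalIntegral.integral_const_mul] at hb
  have := abs_re_le_norm (∫ t in (-a)..a, (starRingEnd ℂ) (h t) * m (t - l))
  rw [neg_re, mul_neg, abs_neg, abs_mul, abs_two]
  linarith

/-! ### Upper and lower estimates by the `L²` norm of `h` -/

/-- Cauchy–Schwarz, from the nonnegative integral of the squared deviation of `‖h‖` from its mean.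
-/
theorem sq_integral_norm_le {a : ℝ} (ha : 0 < a) {h : ℝ → ℂ} (hh : Continuous h) :
    (∫ t in (-a)..a, ‖h t‖) ^ 2 ≤ 2 * a * ∫ t in (-a)..a, ‖h t‖ ^ 2 := by
  set J := ∫ t in (-a)..a, ‖h t‖ with hJ
  have h0 : 0 ≤ ∫ t in (-a)..a, (‖h t‖ - J / (2 * a)) ^ 2 :=
    intervalIntegral.integral_nonneg (by linarith) fun t _ => sq_nonneg _
  have e : ∀ t, (‖h t‖ - J / (2 * a)) ^ 2 =
      ‖h t‖ ^ 2 - J / a * ‖h t‖ + (J / (2 * a)) ^ 2 := by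
    intro t; field_simp; ring
  simp_rw [e] at h0
  rw [intervalIntegral.integral_add (Continuous.intervalIntegrable (by fun_prop) _ _)
    (Continuous.intervalIntegrable (by fun_prop) _ _),
    intervalIntegral.integral_sub (Continuous.intervalIntegrable (by fun_prop) _ _)
    (Continuous.intervalIntegrable (by fun_prop) _ _),
    intervalIntegral.integral_const_mul, intervalIntegral.integral_const, ← hJ, smul_eq_mul] at h0
  have e2 : 2 * a * (((∫ t in (-a)..a, ‖h t‖ ^ 2) - J / a * J) + (a - -a) * (J / (2 * a)) ^ 2) =
      2 * a * (∫ t in (-a)..a, ‖h t‖ ^ 2) - J ^ 2 := by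
    field_simp; ring
  have := mul_nonneg (show 0 ≤ 2 * a by linarith) h0
  rw [e2] at this
  linarith

theorem norm_expConv_le {a c : ℝ} {h : ℝ → ℂ} (hh : Continuous h) {t : ℝ} (ht : t ∈ Icc (-a) a) :
    ‖expConv a c h t‖ ≤ Real.exp (2 * a * |c|) * ∫ u in (-a)..a, ‖h u‖ := by
  rw [expConv_eq_integral]
  have h1 : ‖∫ u in (-a)..t, (Real.exp (-c * (t - u)) : ℂ) * h u‖ ≤
      ∫ u in (-a)..t, Real.exp (2 * a * |c|) * ‖h u‖ := by
    refine intervalIntegral.norm_integral_le_of_norm_le ht.1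
      (Filter.Eventually.of_forall fun u hu => ?_) (Continuous.intervalIntegrable (by fun_prop) _ _)
    rw [norm_mul, norm_real, Real.norm_of_nonneg (Real.exp_pos _).le]
    refine mul_le_mul_of_nonneg_right (Real.exp_le_exp.2 ?_) (norm_nonneg _)
    calc -c * (t - u) ≤ |c| * (t - u) :=
          mul_le_mul_of_nonneg_right (neg_le_abs c) (by linarith [hu.2])
      _ ≤ |c| * (2 * a) :=
          mul_le_mul_of_nonneg_left (by linarith [hu.1, ht.2]) (abs_nonneg c)
      _ = _ := by ring
  rw [intervalIntegral.integral_const_mul] at h1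
  refine h1.trans ?_
  gcongr
  exact intervalIntegral.integral_mono_interval le_rfl ht.1 ht.2
    (Filter.Eventually.of_forall fun s => norm_nonneg _) (hh.norm.intervalIntegrable _ _)

theorem norm_integral_conj_mul_le {a B : ℝ} (ha : 0 < a) {h E : ℝ → ℂ} (hh : Continuous h)
    (hB : ∀ t ∈ Icc (-a) a, ‖E t‖ ≤ B) :
    ‖∫ t in (-a)..a, (starRingEnd ℂ) (h t) * E t‖ ≤ B * ∫ t in (-a)..a, ‖h t‖ := by
  rw [← intervalIntegral.integral_const_mul]
  refine intervalIntegral.norm_integral_le_of_norm_le (by linarith)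
    (Filter.Eventually.of_forall fun t ht => ?_) (Continuous.intervalIntegrable (by fun_prop) _ _)
  rw [norm_mul, RCLike.norm_conj, mul_comm]
  gcongr
  exact hB t (Ioc_subset_Icc_self ht)

/-- An upper bound is the useful one for `c = ±1/2`, because `e^{±|x|/2}` enters `g` with the
coefficient `-4`. -/
theorem DirichletPair.convForm_exp_re_le {a : ℝ} {h f : ℝ → ℂ} (H : DirichletPair a h f) (c : ℝ) :
    (convForm a f (fun x => Real.exp (-c * |x|))).re ≤
      (2 * c + 2 * c ^ 2 * (Real.exp (2 * a * |c|) * (2 * a))) * ∫ t in (-a)..a, ‖h t‖ ^ 2 := by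
  have hh := H.cont_h
  rw [H.convForm_exp_re]
  have h1 := norm_integral_conj_mul_le H.pos hh (E := expConv a c h)
    (fun t ht => norm_expConv_le hh ht)
  have h2 := sq_integral_norm_le H.pos hh
  have h3 := neg_le_of_abs_le (abs_re_le_norm
    (∫ t in (-a)..a, (starRingEnd ℂ) (h t) * expConv a c h t))
  have h4 : Real.exp (2 * a * |c|) * (∫ u in (-a)..a, ‖h u‖) * (∫ u in (-a)..a, ‖h u‖) ≤
      Real.exp (2 * a * |c|) * (2 * a * ∫ t in (-a)..a, ‖h t‖ ^ 2) := by
    rw [mul_assoc, ← sq]; gcongr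
  have h5 : -(Real.exp (2 * a * |c|) * (2 * a * ∫ t in (-a)..a, ‖h t‖ ^ 2)) ≤
    (∫ t in (-a)..a, (starRingEnd ℂ) (h t) * expConv a c h t).re := by linarith
  have h6 := mul_le_mul_of_nonneg_left h5 (show 0 ≤ 2 * c ^ 2 by positivity)
  linarith

/-- As `h = p'`, the convolution equals `p - c · expConv a c p`, so it is controlled by the supremum
of the primitive. This is where the smallness coming from `N` enters. -/
theorem DirichletPair.norm_expConv_deriv_le {a c P : ℝ} {p h : ℝ → ℂ} (H : DirichletPair a p h)
    (hc : 0 ≤ c) (hP : ∀ t ∈ Icc (-a) a, ‖p t‖ ≤ P) {t : ℝ} (ht : t ∈ Icc (-a) a) :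
    ‖expConv a c h t‖ ≤ (1 + 2 * a * c) * P := by
  have ha := H.pos
  have hP0 : 0 ≤ P := (norm_nonneg _).trans (hP t ht)
  rw [H.expConv_deriv]
  have h1 : ‖expConv a c p t‖ ≤ P * (2 * a) := by
    rw [expConv_eq_integral]
    have h2 : ‖∫ u in (-a)..t, (Real.exp (-c * (t - u)) : ℂ) * p u‖ ≤ P * |t - -a| := by
      refine intervalIntegral.norm_integral_le_of_norm_le_const fun u hu => ?_
      rw [uIoc_of_le ht.1] at hu
      rw [norm_mul, norm_real, Real.norm_of_nonneg (Real.exp_pos _).le, ← one_mul P]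
      gcongr
      · refine Real.exp_le_one_iff.2 ?_
        have := mul_nonneg hc (sub_nonneg.2 hu.2)
        linarith
      · exact hP u ⟨hu.1.le, hu.2.trans ht.2⟩
    refine h2.trans ?_
    rw [abs_of_nonneg (by linarith [ht.1])]
    gcongr
    linarith [ht.2]
  refine (norm_sub_le _ _).trans ?_
  rw [norm_mul, norm_real, Real.norm_of_nonneg hc]
  have := hP t ht
  have := mul_le_mul_of_nonneg_left h1 hc
  linarith

theorem DirichletPair.le_convForm_exp_re {a c δ P : ℝ} {p h f : ℝ → ℂ} (H : DirichletPair a h f)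
    (Hp : DirichletPair a p h) (hc : 0 ≤ c) (hP : ∀ t ∈ Icc (-a) a, ‖p t‖ ≤ P)
    (hPδ : P * (∫ t in (-a)..a, ‖h t‖) ≤ δ) :
    2 * c * (∫ t in (-a)..a, ‖h t‖ ^ 2) - 2 * c ^ 2 * ((1 + 2 * a * c) * δ) ≤
      (convForm a f (fun x => Real.exp (-c * |x|))).re := by
  have ha := H.pos
  rw [H.convForm_exp_re]
  have h1 := norm_integral_conj_mul_le H.pos H.cont_h (E := expConv a c h)
    (fun t ht => Hp.norm_expConv_deriv_le hc hP ht)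
  have h2 := (re_le_norm (∫ t in (-a)..a, (starRingEnd ℂ) (h t) * expConv a c h t)).trans h1
  have h3 : (1 + 2 * a * c) * P * (∫ t in (-a)..a, ‖h t‖) ≤ (1 + 2 * a * c) * δ := by
    rw [mul_assoc]; gcongr
  gcongr
  linarith

/-! ### Infinite positive combinations of exponentials -/

theorem continuous_tsum_exp {b c : ℕ → ℝ} (hb : ∀ n, 0 ≤ b n) (hc : ∀ n, 0 ≤ c n)
    (hs : Summable b) : Continuous fun x : ℝ => ∑' n, b n * Real.exp (-c n * |x|) := by
  refine continuous_tsum (fun n => by fun_prop) hs fun n x => ?_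
  rw [norm_mul, Real.norm_of_nonneg (hb n), Real.norm_of_nonneg (Real.exp_pos _).le]
  refine mul_le_of_le_one_right (hb n) (Real.exp_le_one_iff.2 ?_)
  have := mul_nonneg (hc n) (abs_nonneg x)
  linarith

/-- A partial sum bounds from below the form of a positive combination of exponentials. -/
theorem DirichletPair.sum_le_convForm_tsum {a : ℝ} {h f : ℝ → ℂ} (H : DirichletPair a h f)
    {b c : ℕ → ℝ} (hb : ∀ n, 0 ≤ b n) (hc : ∀ n, 0 ≤ c n) (hs : Summable b) (M : ℕ) :
    ∑ n ∈ Finset.range M, b n * (convForm a f (fun x => Real.exp (-c n * |x|))).re ≤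
      (convForm a f (fun x => ∑' n, b n * Real.exp (-c n * |x|))).re := by
  have hf := H.cont
  obtain ⟨B, hB⟩ := isCompact_Icc.exists_bound_of_continuousOn (hf.continuousOn (s := Icc (-a) a))
  set D := B * B * (2 * a) ^ 2 with hD
  have hle1 : ∀ n x, Real.exp (-c n * |x|) ≤ 1 := fun n x => by
    refine Real.exp_le_one_iff.2 ?_
    have := mul_nonneg (hc n) (abs_nonneg x)
    linarith
  have hterm : ∀ x n, 0 ≤ b n * Real.exp (-c n * |x|) := fun x n =>
    mul_nonneg (hb n) (Real.exp_pos _).le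
  have hsx : ∀ x, Summable fun n => b n * Real.exp (-c n * |x|) := fun x =>
    Summable.of_nonneg_of_le (hterm x) (fun n => mul_le_of_le_one_right (hb n) (hle1 n x)) hs
  have hsplit : ∀ m, (convForm a f (fun x => ∑' n, b n * Real.exp (-c n * |x|))).re =
      ∑ n ∈ Finset.range m, b n * (convForm a f (fun x => Real.exp (-c n * |x|))).re +
      (convForm a f (fun x => ∑' n, b (n + m) * Real.exp (-c (n + m) * |x|))).re := by
    intro m
    have e : (fun x : ℝ => ∑' n, b n * Real.exp (-c n * |x|)) = fun x =>
        (∑ n ∈ Finset.range m, b n * Real.exp (-c n * |x|)) +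
          ∑' n, b (n + m) * Real.exp (-c (n + m) * |x|) := by
      ext x; exact ((hsx x).sum_add_tsum_nat_add m).symm
    rw [e, convForm_add a hf (by fun_prop) (continuous_tsum_exp (fun n => hb _) (fun n => hc _)
      ((summable_nat_add_iff m).2 hs)), convForm_sum a hf _ (fun i => by fun_prop), add_re, re_sum]
    congr 1
    refine Finset.sum_congr rfl fun n _ => ?_
    rw [convForm_const_mul, re_ofReal_mul]
  -- The tail is bounded by a multiple of the remainder of `∑ b n`, with a factor `D` depending on
  -- `f`; this is harmless because `m → ∞` with `f` fixed.
  have htail : ∀ m, -((∑' n, b (n + m)) * D) ≤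
      (convForm a f (fun x => ∑' n, b (n + m) * Real.exp (-c (n + m) * |x|))).re := by
    intro m
    refine neg_le_of_abs_le ((abs_re_le_norm _).trans (norm_convForm_le H.pos hB fun x => ?_))
    rw [abs_of_nonneg (tsum_nonneg fun n => hterm x _)]
    exact ((summable_nat_add_iff m).2 (hsx x)).tsum_le_tsum
      (fun n => mul_le_of_le_one_right (hb _) (hle1 _ x)) ((summable_nat_add_iff m).2 hs)
  have hlim : Filter.Tendsto (fun m =>
      ∑ n ∈ Finset.range M, b n * (convForm a f (fun x => Real.exp (-c n * |x|))).re -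
        (∑' n, b (n + m)) * D) Filter.atTop
      (nhds (∑ n ∈ Finset.range M, b n * (convForm a f (fun x => Real.exp (-c n * |x|))).re)) := by
    simpa using (tendsto_sum_nat_add b).mul_const D |>.const_sub
      (∑ n ∈ Finset.range M, b n * (convForm a f (fun x => Real.exp (-c n * |x|))).re)
  refine le_of_tendsto hlim ?_
  filter_upwards [Filter.eventually_ge_atTop M] with m hm
  rw [hsplit m]
  have := htail m
  have := Finset.sum_le_sum_of_subset_of_nonneg (Finset.range_mono hm) fun n _ _ =>
    mul_nonneg (hb n) (H.convForm_exp_nonneg (hc n))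
  linarith

/-! ### Decomposition of the screw function -/

/-- The exponents `2n + 1/2` of the archimedean part of the screw function. -/
noncomputable def archExponent (n : ℕ) : ℝ := 2 * n + 1 / 2

theorem archExponent_pos (n : ℕ) : 0 < archExponent n := by unfold archExponent; positivity

theorem summable_archExponent : Summable fun n => (archExponent n ^ 2)⁻¹ := by
  have h := (summable_nat_add_iff 1).2 (Real.summable_one_div_nat_pow.2 one_lt_two)
  refine Summable.of_nonneg_of_le (fun n => by positivity) (fun n => ?_) (h.mul_left 4)
  have := archExponent_pos n
  rw [mul_one_div, inv_eq_one_div, div_le_div_iff₀ (by positivity) (by positivity)]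
  unfold archExponent
  push_cast
  nlinarith [(Nat.cast_nonneg n : (0 : ℝ) ≤ n)]

/-- Comparison with the harmonic series. This divergence is what allows `μ` to be arbitrary. -/
theorem tendsto_sum_archExponent :
    Filter.Tendsto (fun m => ∑ n ∈ Finset.range m, 2 / archExponent n) Filter.atTop
      Filter.atTop := by
  refine Filter.tendsto_atTop_mono (fun m => Finset.sum_le_sum fun n _ => ?_)
    Real.tendsto_sum_range_one_div_nat_succ_atTop
  have := archExponent_pos n
  rw [div_le_div_iff₀ (by positivity) this]
  unfold archExponent
  linarith

/-- The constant `Γ'/Γ(1/4) - log π`. -/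
noncomputable def linearCoeff : ℝ := logDeriv Real.Gamma (1 / 4) - Real.log Real.pi

/-- A globally continuous kernel that agrees with the screw function on a bounded interval,
the sum over prime powers being extended to all `n ≤ M`. -/
noncomputable def truncScrew (M : ℕ) (x : ℝ) : ℝ :=
  -4 * Real.exp (-(-1 / 2) * |x|) + (-4 * Real.exp (-(1 / 2) * |x|) +
    (∑ n ∈ Finset.Icc 1 M, ArithmeticFunction.vonMangoldt n / Real.sqrt n *
      max 0 (|x| - Real.log n) +
    (-(linearCoeff / 2) * max 0 (|x| - 0) +
    ((8 - (Real.pi ^ 2 + 8 * catalan) / 4) +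
    ∑' n, (archExponent n ^ 2)⁻¹ * Real.exp (-archExponent n * |x|)))))

theorem continuous_truncScrew (M : ℕ) : Continuous (truncScrew M) := by
  have := continuous_tsum_exp (fun n => by positivity) (fun n => (archExponent_pos n).le)
    summable_archExponent
  unfold truncScrew
  fun_prop

theorem truncScrew_neg (M : ℕ) (x : ℝ) : truncScrew M (-x) = truncScrew M x := by
  simp [truncScrew]

theorem hurwitzLerch_eq (t : ℝ) :
    1 / 4 * (Real.exp (-t / 2) * hurwitzLerch (Real.exp (-2 * t)) 2 (1 / 4)) =
      ∑' n, (archExponent n ^ 2)⁻¹ * Real.exp (-archExponent n * t) := by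
  unfold hurwitzLerch
  rw [← tsum_mul_left, ← tsum_mul_left]
  congr 1; ext n
  rw [Real.rpow_neg (by positivity), Real.rpow_two, ← Real.exp_nat_mul]
  have e : Real.exp (-archExponent n * t) = Real.exp (-t / 2) * Real.exp (n * (-2 * t)) := by
    rw [← Real.exp_add]; congr 1; unfold archExponent; ring
  rw [e]
  have e2 : archExponent n ^ 2 = 4 * ((n : ℝ) + 1 / 4) ^ 2 := by unfold archExponent; ring
  rw [e2, mul_inv]
  ring

/-- For `n > e^{|x|}` the positive part `(|x| - log n)₊` vanishes, so the range of summation can be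
made independent of `x`. -/
theorem screw_eq_truncScrew {b x : ℝ} (hx : |x| ≤ b) :
    screw x = truncScrew ⌊Real.exp b⌋₊ x := by
  unfold screw Psi psiNonneg truncScrew
  have hsum : ∑ n ∈ Finset.Icc 1 ⌊Real.exp |x|⌋₊,
      ArithmeticFunction.vonMangoldt n / Real.sqrt n * (|x| - Real.log n) =
      ∑ n ∈ Finset.Icc 1 ⌊Real.exp b⌋₊,
        ArithmeticFunction.vonMangoldt n / Real.sqrt n * max 0 (|x| - Real.log n) := by
    rw [← Finset.sum_subset (Finset.Icc_subset_Icc_right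
      (Nat.floor_le_floor (Real.exp_le_exp.2 hx)))]
    · refine Finset.sum_congr rfl fun n hn => ?_
      rw [Finset.mem_Icc] at hn
      have h1 : (n : ℝ) ≤ Real.exp |x| := (Nat.le_floor_iff (Real.exp_pos _).le).1 hn.2
      have h2 : Real.log n ≤ |x| := by
        rw [Real.log_le_iff_le_exp (by exact_mod_cast hn.1)]; exact h1
      rw [max_eq_right (by linarith)]
    · intro n hn hn'
      rw [Finset.mem_Icc] at hn hn'
      have h1 : Real.exp |x| < n := Nat.lt_of_floor_lt (by
        by_contra h; exact hn' ⟨hn.1, not_lt.1 h⟩)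
      have h2 : |x| < Real.log n := by
        rw [Real.lt_log_iff_exp_lt (by exact_mod_cast hn.1)]; exact h1
      rw [max_eq_left (by linarith), mul_zero]
  rw [hsum, ← hurwitzLerch_eq, sub_zero, max_eq_right (abs_nonneg x)]
  rw [show -(-1 / 2) * |x| = |x| / 2 by ring, show -(1 / 2) * |x| = -|x| / 2 by ring]
  unfold linearCoeff
  ring

theorem DirichletPair.convForm_truncScrew {a : ℝ} {h f : ℝ → ℂ} (H : DirichletPair a h f) (M : ℕ) :
    (convForm a f (truncScrew M)).re =
      -4 * (convForm a f (fun x => Real.exp (-(-1 / 2) * |x|))).re +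
      (-4 * (convForm a f (fun x => Real.exp (-(1 / 2) * |x|))).re +
      (∑ n ∈ Finset.Icc 1 M, ArithmeticFunction.vonMangoldt n / Real.sqrt n *
        (convForm a f (fun x => max 0 (|x| - Real.log n))).re +
      (-(linearCoeff / 2) * (convForm a f (fun x => max 0 (|x| - 0))).re +
      (convForm a f (fun x => ∑' n, (archExponent n ^ 2)⁻¹ *
        Real.exp (-archExponent n * |x|))).re))) := by
  have hS := continuous_tsum_exp (fun n => by positivity) (fun n => (archExponent_pos n).le)
    summable_archExponent
  have hf := H.cont
  unfold truncScrew
  rw [convForm_add a hf (by fun_prop) (by fun_prop), convForm_add a hf (by fun_prop) (by fun_prop),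
    convForm_add a hf (by fun_prop) (by fun_prop), convForm_add a hf (by fun_prop) (by fun_prop),
    convForm_add a hf (by fun_prop) (by fun_prop), convForm_sum a hf _ (fun i => by fun_prop),
    H.convForm_const, zero_add]
  simp only [convForm_const_mul, add_re, re_sum, re_ofReal_mul]

/-- The first `m` archimedean terms give the gain `∑ 2/cₙ` and an error proportional to `δ`. In the
loss, the contributions `2c` for `c = ±1/2` cancel, leaving `4 · 2a e^a ≤ 8a₀e^{a₀}`; each kink
costs twice its weight. -/
theorem DirichletPair.le_convForm_truncScrew {a a₀ δ P : ℝ} (haa : a ≤ a₀) {p h f : ℝ → ℂ}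
    (H : DirichletPair a h f) (Hp : DirichletPair a p h) (hP : ∀ t ∈ Icc (-a) a, ‖p t‖ ≤ P)
    (hPδ : P * (∫ t in (-a)..a, ‖h t‖) ≤ δ * ∫ t in (-a)..a, ‖h t‖ ^ 2) (hδ : 0 ≤ δ) (M m : ℕ) :
    (∑ n ∈ Finset.range m, 2 / archExponent n -
      (∑ n ∈ Finset.range m, 2 * (1 + 2 * a₀ * archExponent n)) * δ -
      (8 * a₀ * Real.exp a₀ +
        2 * ∑ n ∈ Finset.Icc 1 M, ArithmeticFunction.vonMangoldt n / Real.sqrt n +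
        |linearCoeff|)) * (∫ t in (-a)..a, ‖h t‖ ^ 2) ≤ (convForm a f (truncScrew M)).re := by
  have ha := H.pos
  set A := ∫ t in (-a)..a, ‖h t‖ ^ 2 with hA
  have hA0 : 0 ≤ A := intervalIntegral.integral_nonneg (by linarith) fun x _ => by positivity
  have hexp : Real.exp a * a ≤ Real.exp a₀ * a₀ := by gcongr
  have h1 := H.convForm_exp_re_le (-1 / 2)
  have h2 := H.convForm_exp_re_le (1 / 2)
  rw [show |(-1 / 2 : ℝ)| = 1 / 2 by rw [abs_of_neg] <;> norm_num] at h1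
  rw [show |(1 / 2 : ℝ)| = 1 / 2 by rw [abs_of_pos]; norm_num] at h2
  rw [show 2 * a * (1 / 2) = a by ring, ← hA] at h1 h2
  have h12 := mul_le_mul_of_nonneg_right hexp hA0
  have h3 : -(2 * (∑ n ∈ Finset.Icc 1 M, ArithmeticFunction.vonMangoldt n / Real.sqrt n) * A) ≤
      ∑ n ∈ Finset.Icc 1 M, ArithmeticFunction.vonMangoldt n / Real.sqrt n *
        (convForm a f (fun x => max 0 (|x| - Real.log n))).re := by
    rw [mul_assoc, Finset.sum_mul, Finset.mul_sum, ← Finset.sum_neg_distrib]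
    refine Finset.sum_le_sum fun n hn => ?_
    have h0 : 0 ≤ Real.log n := Real.log_natCast_nonneg n
    have hk := neg_le_of_abs_le (H.convForm_kink_re h0)
    have hw : 0 ≤ ArithmeticFunction.vonMangoldt n / Real.sqrt n :=
      div_nonneg ArithmeticFunction.vonMangoldt_nonneg (Real.sqrt_nonneg _)
    have := mul_le_mul_of_nonneg_left hk hw
    linarith
  have h4 : -(|linearCoeff| * A) ≤
      -(linearCoeff / 2) * (convForm a f (fun x => max 0 (|x| - 0))).re := by
    refine neg_le_of_abs_le ?_
    rw [abs_mul, abs_neg, abs_div, abs_two]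
    have := mul_le_mul_of_nonneg_left (H.convForm_kink_re le_rfl)
      (show 0 ≤ |linearCoeff| / 2 by positivity)
    linarith
  have h5 := H.sum_le_convForm_tsum (b := fun n => (archExponent n ^ 2)⁻¹) (c := archExponent)
    (fun n => by positivity) (fun n => (archExponent_pos n).le) summable_archExponent m
  have h6 : (∑ n ∈ Finset.range m, 2 / archExponent n -
      (∑ n ∈ Finset.range m, 2 * (1 + 2 * a₀ * archExponent n)) * δ) * A ≤
      ∑ n ∈ Finset.range m, (archExponent n ^ 2)⁻¹ *
        (convForm a f (fun x => Real.exp (-archExponent n * |x|))).re := by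
    rw [Finset.sum_mul, ← Finset.sum_sub_distrib, Finset.sum_mul]
    refine Finset.sum_le_sum fun n _ => ?_
    have hc := archExponent_pos n
    have := mul_le_mul_of_nonneg_left (H.le_convForm_exp_re Hp hc.le hP hPδ)
      (show 0 ≤ (archExponent n ^ 2)⁻¹ by positivity)
    refine le_trans ?_ this
    rw [← hA]
    have e : (archExponent n ^ 2)⁻¹ * (2 * archExponent n * A -
        2 * archExponent n ^ 2 * ((1 + 2 * a * archExponent n) * (δ * A))) =
        (2 / archExponent n - 2 * (1 + 2 * a * archExponent n) * δ) * A := by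
      field_simp
    rw [e]
    gcongr
  rw [H.convForm_truncScrew]
  linarith

/-! ### From `φ` to its primitive `h` -/

theorem integrable_of_mem_L2 {a : ℝ} {φ : ℝ → ℂ} (hφ : φ ∈ L2 a) : Integrable φ := by
  have h : IntegrableOn φ (Icc (-a) a) := by
    have : IsFiniteMeasure (volume.restrict (Icc (-a) a)) := ⟨by simp⟩
    exact (hφ.1.restrict (Icc (-a) a)).integrable one_le_two
  exact (integrableOn_iff_integrable_of_support_subset hφ.2).1 h

theorem eq_zero_of_mem_L2 {a : ℝ} {φ : ℝ → ℂ} (hφ : φ ∈ L2 a) {t : ℝ} (ht : a < |t|) :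
    φ t = 0 := by
  by_contra h
  exact absurd (abs_le.2 (hφ.2 h)) (not_le.2 ht)

/-- Lebesgue differentiation identifies `φ` with `h'` a.e., and `φ̂(0) = 0` gives `h(a) = 0`. The
second derivative `g` is kept for the decay of the Fourier transform of the cut-off `h`. -/
theorem exists_dirichletPair {N : ℕ} {a : ℝ} (ha : 0 < a) {φ : ℝ → ℂ} (hφ : φ ∈ KN0 N a) :
    ∃ h f g : ℝ → ℂ, DirichletPair a h f ∧ (∀ t, HasDerivAt f (g t) t) ∧ Continuous g ∧
      (∀ᵐ t, t ∈ Icc (-a) a → φ t = f t) ∧ (∀ t, |t| ≤ a → primitive a φ t = h t) ∧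
      ∀ n : ℤ, |n| ≤ (N : ℤ) →
        ∫ x in (-a)..a, h x * cexp (Real.pi * I * n * x / a) = 0 := by
  obtain ⟨hL2, hhat, ⟨⟨h, hsm, _, heq, hout⟩, hcoef⟩⟩ := hφ
  have hab : -a ≤ a := by linarith
  have hint := integrable_of_mem_L2 hL2
  have hd : ∀ t, HasDerivAt h (deriv h t) t := fun t =>
    (hsm.differentiable (by simp) t).hasDerivAt
  have hsm1 : ContDiff ℝ ∞ (deriv h) := (contDiff_infty_iff_deriv.1 hsm).2
  have hsm2 : ContDiff ℝ ∞ (deriv (deriv h)) := (contDiff_infty_iff_deriv.1 hsm1).2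
  refine ⟨h, deriv h, deriv (deriv h), ⟨ha, hd, hsm1.continuous, ?_, ?_⟩, fun t =>
    (hsm1.differentiable (by simp) t).hasDerivAt, hsm2.continuous, ?_, heq, ?_⟩
  · rw [← heq (-a) (by rw [abs_neg, abs_of_pos ha])]
    simp [primitive]
  · rw [← heq a (by rw [abs_of_pos ha]), primitive, ← hhat, hat_of_ae_eq ha.le
      (fun t ht => eq_zero_of_mem_L2 hL2 ht) (Filter.Eventually.of_forall fun t _ => rfl)]
    simp
  · have hne1 : ∀ᵐ t : ℝ, t ≠ -a := by simp [ae_iff, measure_singleton]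
    have hne2 : ∀ᵐ t : ℝ, t ≠ a := by simp [ae_iff, measure_singleton]
    filter_upwards [(hint.intervalIntegrable (a := -a) (b := a)).ae_hasDerivAt_integral,
      hne1, hne2] with t ht h1 h2 hm
    have hder := ht (by rwa [uIcc_of_le hab]) (-a) left_mem_uIcc
    have hmem : t ∈ Ioo (-a) a := ⟨lt_of_le_of_ne hm.1 (Ne.symm h1), lt_of_le_of_ne hm.2 h2⟩
    refine hder.unique ((hd t).congr_of_eventuallyEq ?_)
    filter_upwards [isOpen_Ioo.mem_nhds hmem] with s hs
    exact heq s (abs_le.2 ⟨hs.1.le, hs.2.le⟩)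
  · intro n hn
    rw [← hcoef n hn]
    refine intervalIntegral.integral_congr fun x hx => ?_
    rw [uIcc_of_le hab] at hx
    rw [heq x (abs_le.2 hx)]

/-- With `ψ` the primitive, integration by parts gives `φ̂(z) = -iz ψ̂(z)`, so `|Φ₁| = |ψ̂|` off `z
= 0`, and Plancherel applies to `ψ`. -/
theorem integral_norm_sq_Phi1 {N : ℕ} {a : ℝ} (ha : 0 < a) {φ h f g : ℝ → ℂ} (hφ : φ ∈ KN0 N a)
    (H : DirichletPair a h f) (hg : ∀ t, HasDerivAt f (g t) t) (hgc : Continuous g)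
    (hae : ∀ᵐ t, t ∈ Icc (-a) a → φ t = f t) (heq : ∀ t, |t| ≤ a → primitive a φ t = h t) :
    Integrable (fun z : ℝ => ‖Phi1 φ z‖ ^ 2) ∧
      ∫ z : ℝ, ‖Phi1 φ z‖ ^ 2 = 2 * Real.pi * ∫ t in (-a)..a, ‖h t‖ ^ 2 := by
  have hab : -a ≤ a := by linarith
  obtain ⟨hL2, hhat, ⟨⟨_, _, _, _, hout⟩, _⟩⟩ := hφ
  have hint := integrable_of_mem_L2 hL2
  set ψ := primitive a φ with hψ
  have hψc : Continuous ψ := intervalIntegral.continuous_primitive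
    (fun _ _ => hint.intervalIntegrable) _
  have hψs : HasCompactSupport ψ := HasCompactSupport.intro isCompact_Icc fun t ht => hout t (by
    by_contra hcon
    exact ht (abs_le.1 (not_lt.1 hcon)))
  have hψi : Integrable ψ := hψc.integrable_of_hasCompactSupport hψs
  have hhi := integrable_hat_cutoff ha.le H.deriv hg hgc H.left H.right heq hout hψi
  obtain ⟨h1, h2⟩ := integral_norm_sq_hat hψc hψi hhi
  have hPhi : ∀ z : ℝ, z ≠ 0 → ‖Phi1 φ z‖ = ‖hat ψ z‖ := by
    intro z hz
    have e1 := integral_deriv_mul_cexp a H.deriv H.cont (I * z)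
    rw [H.left, H.right] at e1
    rw [Phi1, hhat, hat_of_ae_eq ha.le (fun t ht => eq_zero_of_mem_L2 hL2 ht) hae, e1,
      hat_of_ae_eq ha.le hout (Filter.Eventually.of_forall fun t ht => heq t (abs_le.2 ht))]
    simp [hz]
  have hae2 : (fun z : ℝ => ‖hat ψ z‖ ^ 2) =ᵐ[volume] fun z : ℝ => ‖Phi1 φ z‖ ^ 2 := by
    have hne : ∀ᵐ z : ℝ, z ≠ 0 := by simp [ae_iff, measure_singleton]
    filter_upwards [hne] with z hz
    rw [hPhi z hz]
  refine ⟨h1.congr hae2, ?_⟩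
  rw [← integral_congr_ae hae2, h2]
  congr 1
  rw [intervalIntegral.integral_of_le hab, ← integral_Icc_eq_integral_Ioc,
    ← setIntegral_eq_integral_of_forall_compl_eq_zero (s := Icc (-a) a)]
  · refine setIntegral_congr_fun measurableSet_Icc fun t ht => ?_
    rw [heq t (abs_le.2 ht)]
  · intro t ht
    rw [hout t (by
      by_contra hcon
      exact ht (abs_le.1 (not_lt.1 hcon)))]
    simp

/-- On functions of mean zero, the form of `G_g` only sees the term `g(t-u)`. -/
theorem form_eq_convForm {a : ℝ} {g k : ℝ → ℝ} {φ h f : ℝ → ℂ} (H : DirichletPair a h f)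
    (hk : Continuous k) (hgk : ∀ x, |x| ≤ 2 * a → g x = k x)
    (hae : ∀ᵐ t, t ∈ Icc (-a) a → φ t = f t) : form g a φ φ = convForm a f k := by
  have ha := H.pos
  have hab : -a ≤ a := by linarith
  have hf := H.cont
  have hc : Continuous (starRingEnd ℂ) := continuous_conj
  set C := ∫ u in (-a)..a, (k (-u) : ℂ) * f u with hC
  have inner : ∀ᵐ t, t ∈ uIoc (-a) a → ∫ u in (-a)..a, formIntegrand g φ φ t u =
      (∫ u in (-a)..a, (k (t - u) : ℂ) * f u * (starRingEnd ℂ) (f t)) -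
        C * (starRingEnd ℂ) (f t) := by
    filter_upwards [hae] with t ht hm
    rw [uIoc_of_le hab] at hm
    have hφt := ht (Ioc_subset_Icc_self hm)
    have e1 : ∫ u in (-a)..a, formIntegrand g φ φ t u = ∫ u in (-a)..a,
        ((k (t - u) : ℂ) * f u * (starRingEnd ℂ) (f t) - (k (-u) : ℂ) * f u * (starRingEnd ℂ) (f t)
          + ((k 0 - k t : ℝ) : ℂ) * (starRingEnd ℂ) (f t) * f u) := by
      refine intervalIntegral.integral_congr_ae ?_
      filter_upwards [hae] with u hu hmu
      rw [uIoc_of_le hab] at hmu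
      unfold formIntegrand kernel
      rw [hφt, hu (Ioc_subset_Icc_self hmu), hgk (t - u) (abs_le.2 ⟨by linarith [hm.1, hmu.2],
        by linarith [hm.2, hmu.1]⟩), hgk t (abs_le.2 ⟨by linarith [hm.1], by linarith [hm.2]⟩),
        hgk (-u) (abs_le.2 ⟨by linarith [hmu.2], by linarith [hmu.1]⟩),
        hgk 0 (by rw [abs_zero]; linarith)]
      push_cast; ring
    rw [e1, intervalIntegral.integral_add (Continuous.intervalIntegrable (by fun_prop) _ _)
      (Continuous.intervalIntegrable (by fun_prop) _ _),
      intervalIntegral.integral_sub (Continuous.intervalIntegrable (by fun_prop) _ _)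
      (Continuous.intervalIntegrable (by fun_prop) _ _), intervalIntegral.integral_const_mul,
      H.integral_eq_zero, mul_zero, add_zero]
    congr 1
    rw [intervalIntegral.integral_mul_const]
  have hconj : ∫ t in (-a)..a, (starRingEnd ℂ) (f t) = 0 := by
    have := congrArg (starRingEnd ℂ) H.integral_eq_zero
    rw [intervalIntegral, map_sub, ← integral_conj, ← integral_conj, map_zero] at this
    rw [intervalIntegral, this]
  unfold form
  rw [intervalIntegral.integral_congr_ae inner, intervalIntegral.integral_sub
    ((continuous_convForm_inner a hf hk).intervalIntegrable _ _)
    (Continuous.intervalIntegrable (by fun_prop) _ _), intervalIntegral.integral_const_mul, hconj,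
    mul_zero, sub_zero]
  rfl

/-- The kernel is continuous on the compact square, and `conj φ(t) φ(u)` is integrable as a product
in separate variables. -/
theorem integrableOn_formIntegrand {a : ℝ} {g k : ℝ → ℝ} {φ : ℝ → ℂ} (hφ : Integrable φ)
    (hk : Continuous k) (hgk : ∀ x, |x| ≤ 2 * a → g x = k x) :
    IntegrableOn (fun p : ℝ × ℝ => formIntegrand g φ φ p.1 p.2)
      (Icc (-a) a ×ˢ Icc (-a) a) := by
  have hc : Continuous (starRingEnd ℂ) := continuous_conj
  have hφc : Integrable fun t => (starRingEnd ℂ) (φ t) :=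
    (conjCLE.toContinuousLinearMap).integrable_comp hφ
  have h1 : Integrable (fun p : ℝ × ℝ => (starRingEnd ℂ) (φ p.1) * φ p.2) := hφc.mul_prod hφ
  have hcont : ContinuousOn (fun p : ℝ × ℝ => ((k (p.1 - p.2) - k p.1 - k (-p.2) + k 0 : ℝ) : ℂ))
      (Icc (-a) a ×ˢ Icc (-a) a) := by fun_prop
  have h2 := IntegrableOn.continuousOn_mul hcont
    (h1.integrableOn (s := Icc (-a) a ×ˢ Icc (-a) a)) (isCompact_Icc.prod isCompact_Icc)
  refine h2.congr_fun (fun p hp => ?_) (measurableSet_Icc.prod measurableSet_Icc)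
  obtain ⟨⟨p1, p2⟩, ⟨p3, p4⟩⟩ := hp
  unfold formIntegrand kernel
  rw [hgk _ (abs_le.2 ⟨by linarith, by linarith⟩), hgk _ (abs_le.2 ⟨by linarith, by linarith⟩),
    hgk (-p.2) (abs_le.2 ⟨by linarith, by linarith⟩), hgk 0 (by rw [abs_zero]; linarith)]
  ring

/-- When enough Fourier coefficients of `h` vanish, its primitive `p` satisfies
`sup ‖p‖ * ‖h‖₁ ≤ δ ‖h‖₂²`. -/
theorem exists_primitive_bound {a₀ δ : ℝ} (ha₀ : 0 < a₀) (hδ : 0 < δ) :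
    ∃ N : ℕ, ∀ a : ℝ, 0 < a → a ≤ a₀ → ∀ h : ℝ → ℂ, Continuous h →
      (∀ n : ℤ, |n| ≤ (N : ℤ) → ∫ x in (-a)..a, h x * cexp (Real.pi * I * n * x / a) = 0) →
      ∃ (p : ℝ → ℂ) (P : ℝ), DirichletPair a p h ∧ (∀ t ∈ Icc (-a) a, ‖p t‖ ≤ P) ∧
        P * (∫ t in (-a)..a, ‖h t‖) ≤ δ * ∫ t in (-a)..a, ‖h t‖ ^ 2 := by
  -- With `‖h‖₁² ≤ 2a‖h‖₂²`, this `ε` makes the square of the product at most `δ²‖h‖₂⁴ (a/a₀)²`.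
  obtain ⟨N, hN⟩ := exists_norm_sq_primitive_le
    (show 0 < δ ^ 2 / (2 * a₀ ^ 2) by positivity)
  refine ⟨N, fun a ha haa h hh hz => ?_⟩
  set A := ∫ t in (-a)..a, ‖h t‖ ^ 2 with hA
  have hA0 : 0 ≤ A := intervalIntegral.integral_nonneg (by linarith) fun x _ => by positivity
  have hd : ∀ t, HasDerivAt (fun t => ∫ u in (-a)..t, h u) (h t) t := fun t =>
    intervalIntegral.integral_hasDerivAt_right (hh.intervalIntegrable (-a) t)
      (hh.stronglyMeasurableAtFilter _ _) hh.continuousAt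
  have h0 : ∫ u in (-a)..a, h u = 0 := by simpa using hz 0 (by simp)
  refine ⟨fun t => ∫ u in (-a)..t, h u, √(δ ^ 2 / (2 * a₀ ^ 2) * a * A),
    ⟨ha, hd, hh, by simp, h0⟩, fun t ht => Real.le_sqrt_of_sq_le
      (hN a ha h _ hd hh (by simp) hz t ht), ?_⟩
  refine le_of_sq_le_sq ?_ (by positivity)
  rw [mul_pow, Real.sq_sqrt (by positivity), mul_pow]
  calc _ ≤ δ ^ 2 / (2 * a₀ ^ 2) * a * A * (2 * a * A) := by
        gcongr
        exact sq_integral_norm_le ha hh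
    _ = δ ^ 2 * A ^ 2 * (a ^ 2 / a₀ ^ 2) := by field_simp
    _ ≤ δ ^ 2 * A ^ 2 * 1 := by
        gcongr
        rw [div_le_one (by positivity)]
        gcongr
    _ = _ := mul_one _

end ZetaScrew


/-! ### Choice of constants and conclusion -/

theorem theorem4p3 (a₀ μ : ℝ) (ha₀ : 0 < a₀) (hμ : 0 < μ) :
    ∃ N : ℕ, ∀ a : ℝ, 0 < a → a ≤ a₀ → ∀ φ ∈ ZetaScrew.KN0 N a,
      MeasureTheory.IntegrableOn
        (fun p : ℝ × ℝ => ZetaScrew.formIntegrand ZetaScrew.screw φ φ p.1 p.2)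
        (Set.Icc (-a) a ×ˢ Set.Icc (-a) a) ∧
      MeasureTheory.Integrable (fun z : ℝ => ‖ZetaScrew.Phi1 φ z‖ ^ 2) ∧
      (ZetaScrew.form ZetaScrew.screw a φ φ).im = 0 ∧
      μ * ∫ z : ℝ, ‖ZetaScrew.Phi1 φ z‖ ^ 2 ≤ (ZetaScrew.form ZetaScrew.screw a φ φ).re := by
  -- Differences `t - u` reach `2a ≤ 2a₀`, so all `n ≤ e^{2a₀}` are included.
  set M := ⌊Real.exp (2 * a₀)⌋₊ with hM
  set C := 8 * a₀ * Real.exp a₀ +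
    2 * ∑ n ∈ Finset.Icc 1 M, ArithmeticFunction.vonMangoldt n / Real.sqrt n + |ZetaScrew.linearCoeff| with hC
  -- `m` is fixed before `δ` and `N`. The spare `1` absorbs the error `Sδ`, which is at most `1` for
  -- `δ = (1 + S)⁻¹`.
  obtain ⟨m, hm⟩ := (ZetaScrew.tendsto_sum_archExponent.eventually_ge_atTop
    (2 * Real.pi * μ + C + 1)).exists
  set S := ∑ n ∈ Finset.range m, 2 * (1 + 2 * a₀ * ZetaScrew.archExponent n) with hS
  have hS0 : 0 ≤ S := Finset.sum_nonneg fun n _ => by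
    have := ZetaScrew.archExponent_pos n
    positivity
  have hδ : 0 < (1 + S)⁻¹ := by positivity
  have hSδ : S * (1 + S)⁻¹ ≤ 1 := by
    rw [← div_eq_mul_inv, div_le_one (by positivity)]; linarith
  obtain ⟨N, hN⟩ := ZetaScrew.exists_primitive_bound ha₀ hδ
  refine ⟨N, fun a ha haa φ hφ => ?_⟩
  obtain ⟨h, f, g, H, hg, hgc, hae, heq, hz⟩ := ZetaScrew.exists_dirichletPair ha hφ
  have hgk : ∀ x, |x| ≤ 2 * a → ZetaScrew.screw x = ZetaScrew.truncScrew M x := fun x hx =>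
    ZetaScrew.screw_eq_truncScrew (hx.trans (by linarith))
  have hk := ZetaScrew.continuous_truncScrew M
  have hform := ZetaScrew.form_eq_convForm H hk hgk hae
  obtain ⟨hPi, hPe⟩ := ZetaScrew.integral_norm_sq_Phi1 ha hφ H hg hgc hae heq
  refine ⟨ZetaScrew.integrableOn_formIntegrand (ZetaScrew.integrable_of_mem_L2 hφ.1) hk hgk, hPi, ?_, ?_⟩
  · rw [hform]; exact ZetaScrew.convForm_im ha H.cont hk (ZetaScrew.truncScrew_neg M)
  · obtain ⟨p, P, Hp, hP, hPδ⟩ := hN a ha haa h H.cont_h hz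
    rw [hform, hPe]
    refine le_trans ?_ (H.le_convForm_truncScrew haa Hp hP hPδ hδ.le M m)
    rw [← mul_assoc]
    refine mul_le_mul_of_nonneg_right ?_
      (intervalIntegral.integral_nonneg (by linarith) fun x _ => by positivity)
    linarith
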